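/- Fix integers $d,n_l,n_f\ge 0$, $Q\ge1$, $M,N\ge 1$, and consider the depth-$Q$ PCS-QCNN on $d$ spatial axes with $n_{\mathrm{idx}}=n_l+Q-1$ index qubits per axis, $n_f$ feature qubits, $D_f=2^{n_f}$, $D_{\mathrm{out}}=2^{dn_l}D_f$, and an $M$-class head, defined as follows. **Quantum core.** At layer $\ell\in\{1,\dots,Q\}$ the active index register has $n_\ell=n_l+Q-\ell$ qubits per axis. Let $\mathcal F^{(\ell)}$ be the $d$-fold tensor power of the quantum Fourier transform $F_{jk}=2^{-n_\ell/2}e^{-2\pi i jk/2^{n_\ell}}$. The branch labels of layer $\ell$ are $\mathcal M_1=\{0\}$ and $\mathcal M_\ell=\{0,1\}^d$ for $\ell\ge2$. For $m\in\mathcal M_\ell$ the layer applies $$U^{(\ell)}(m)=(\mathcal F^{(\ell)\dagger}\otimes 1)\Big(\sum_{k}|k\rangle\langle k|\otimes V_k^{(\ell)}(m)\Big)(\mathcal F^{(\ell)}\otimes 1),\qquad V_k^{(\ell)}(m)=\exp\Big(i\sum_{\alpha}\theta^{(\ell)}_{k,\alpha}(m)P_\alpha\Big),$$ where $k$ runs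 over the $2^{dn_\ell}$ Fourier modes and $P_\alpha$ over all $4^{n_f}$ Pauli strings on the feature register (the identity string included). After each layer $\ell<Q$ the least significant index bit of every axis is measured in the computational basis and discarded; the outcome in $\{0,1\}^d$ is the branch label $m$ of layer $\ell+1$. After layer $Q$ the remaining index and feature registers are measured. Marginalizing all pooling outcomes gives $p_\Theta(\cdot\mid x)\in\mathbb R^{D_{\mathrm{out}}}$, where the input $x$ is encoded as an arbitrary unit vector $|\psi(x)\rangle$ of the initial index and feature registers, and $\Theta$ is the vector of all the real coefficients $\theta^{(\ell)}_{k,\alpha}(m)$; let $P_Q$ be their number. **Head and loss.** Put $q(x)=\mathrm{softmax}(Wp_\Theta(\cdot\mid x)+b)$ with $W\in\mathbb R^{M\times D_{\mathrm{out}}}$, $b\in\mathbb R^M$. For fixed samples $(x_i,c_i)_{i=1}^N$ with labels $c_i\in\{1,\dots,M\}$, let $\mathcal L(\Theta,W,b)=-\frac1N\sum_{i=1}^N\log q_{c_i}(x_i)$ (the case $N=1$ is the single-sample loss) and $G_Q=\nabla_\Theta\mathcal L(\Theta,W,b)\in\mathbb R^{P_Q}$. **Initialization.** All entries of $W$ and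 $b$ are independent and $\mathrm{Unif}(-D_{\mathrm{out}}^{-1/2},D_{\mathrm{out}}^{-1/2})$, and $(W,b)$ is independent of $\Theta$. **Claim.** The parameter count is $$P_Q=4^{n_f}\sum_{\ell=1}^{Q}b_\ell\,2^{d(n_l+Q-\ell)}\ \ge\ 4^{n_f}\,2^{d(n_l+Q-1)},\qquad b_1=1,\ b_\ell=2^d\ (\ell\ge2).$$ For all $W,b$ the loss is differentiable in $\Theta$. For every probability distribution of $\Theta$, in particular when all the coefficients $\theta^{(\ell)}_{k,\alpha}(m)$ are independent and $\mathrm{Unif}(0,2\pi)$, the random variable $\|G_Q\|_2^2$ is integrable and $$\mathbb E\|G_Q\|_2^2\le\frac{8M}{3}\,4^{n_f}\,Q,\qquad \mathbb E\Big[\frac1{P_Q}\|G_Q\|_2^2\Big]\le\frac{8MQ}{3\cdot 2^{d(n_l+Q-1)}}.$$ -/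

import Mathlib

open MeasureTheory
open scoped Kronecker

noncomputable section

namespace PCSQCNN

/-! Conventions.  `d` is the number of spatial axes, `nl` the number of index qubits per axis left
after all poolings, `nf` the number of feature qubits, `Q` the depth and `M` the number of classes.
A layer `ℓ ∈ {1, …, Q}` is labelled by the number `r = Q - ℓ` of poolings that come after it, so
that the first layer has `r = Q - 1`, the last one has `r = 0`, and the active index register at
layer `r` has `nl + r = nl + Q - ℓ` qubits per axis. -/

/-- Basis labels of a `d`-axis index register with `n` qubits per axis (also its Fourier modes). -/
abbrev Idx (d n : ℕ) : Type := Fin d → Fin (2 ^ n)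

/-- Computational basis labels of the feature register. -/
abbrev Feat (nf : ℕ) : Type := Fin nf → Fin 2

/-- Outcomes of one pooling step: one measured bit per axis. -/
abbrev Outcome (d : ℕ) : Type := Fin d → Fin 2

/-- Labels of Pauli strings on `nf` qubits, the all-identity string included. -/
abbrev PauliString (nf : ℕ) : Type := Fin nf → Fin 4

/-- Branch labels available to layer `r`: the most recent pooling outcome; for the first layer
(`r + 1 = Q`), which has no previous pooling, only the label `0`. -/
abbrev Branch (d Q r : ℕ) : Type := {m : Outcome d // r + 1 = Q → m = 0}

/-- The quantum coordinates `θ^{(ℓ)}_{k,α}(m)`: layer, branch label, Fourier mode, Pauli string. -/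
abbrev Coord (d nl nf Q : ℕ) : Type :=
  Σ r : Fin Q, Branch d Q r × Idx d (nl + r) × PauliString nf

/-- The Euclidean space of all quantum parameters `Θ`. -/
abbrev Params (d nl nf Q : ℕ) : Type := EuclideanSpace ℝ (Coord d nl nf Q)

/-- The quantum parameter count `P_Q`. -/
def numParams (d nl nf Q : ℕ) : ℕ := Fintype.card (Coord d nl nf Q)

/-- The single-qubit Pauli matrices `I, X, Y, Z`. -/
def pauli : Fin 4 → Matrix (Fin 2) (Fin 2) ℂ :=
  ![1, !![0, 1; 1, 0], !![0, -Complex.I; Complex.I, 0], !![1, 0; 0, -1]]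

/-- The Pauli string `P_α`, the tensor product of the matrices `pauli (α j)`. -/
def pauliString {nf : ℕ} (α : PauliString nf) : Matrix (Feat nf) (Feat nf) ℂ :=
  Matrix.of fun x y => ∏ j, pauli (α j) (x j) (y j)

/-- The full Pauli-exponential block `exp (i ∑_α θ_α P_α)`. -/
def pauliExp {nf : ℕ} (θ : PauliString nf → ℝ) : Matrix (Feat nf) (Feat nf) ℂ :=
  NormedSpace.exp (Complex.I • ∑ α, (θ α : ℂ) • pauliString α)

/-- The `N`-point quantum Fourier transform, `F_{kj} = N^{-1/2} exp (-2πi k j / N)`. -/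
def qft (N : ℕ) : Matrix (Fin N) (Fin N) ℂ :=
  Matrix.of fun k j =>
    ((Real.sqrt N : ℝ) : ℂ)⁻¹ *
      Complex.exp (-(2 * (Real.pi : ℂ) * Complex.I * (k : ℕ) * (j : ℕ) / (N : ℂ)))

/-- The `d`-fold QFT, a tensor product over the axes. -/
def qftAxes (d n : ℕ) : Matrix (Idx d n) (Idx d n) ℂ :=
  Matrix.of fun k j => ∏ a, qft (2 ^ n) (k a) (j a)

/-- The Fourier multiplexer `∑_k |k⟩⟨k| ⊗ V_k`. -/
def multiplexer {d n nf : ℕ} (V : Idx d n → Matrix (Feat nf) (Feat nf) ℂ) :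
    Matrix (Idx d n × Feat nf) (Idx d n × Feat nf) ℂ :=
  ∑ k, Matrix.single k k (1 : ℂ) ⊗ₖ V k

/-- The PCS-equivariant layer `(F† ⊗ 1) B (F ⊗ 1)`. -/
def layer {d n nf : ℕ} (V : Idx d n → Matrix (Feat nf) (Feat nf) ℂ) :
    Matrix (Idx d n × Feat nf) (Idx d n × Feat nf) ℂ :=
  ((qftAxes d n).conjTranspose ⊗ₖ (1 : Matrix (Feat nf) (Feat nf) ℂ)) * multiplexer V *
    (qftAxes d n ⊗ₖ (1 : Matrix (Feat nf) (Feat nf) ℂ))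

/-- The fine index `2 q + s` with coarse part `q` and least significant bit `s`. -/
def fineIndex {n : ℕ} (q : Fin (2 ^ n)) (s : Fin 2) : Fin (2 ^ (n + 1)) :=
  ⟨2 * (q : ℕ) + (s : ℕ), by
    have hq := q.isLt
    have hs := s.isLt
    rw [pow_succ]
    omega⟩

/-- Parity pooling with outcome `s`: the least significant index bit of every axis is measured in
the computational basis and discarded.  The result is the unnormalized branch state, whose squared
norm carries the probability of the branch. -/
def pool {d n nf : ℕ} (s : Outcome d) (ψ : Idx d (n + 1) × Feat nf → ℂ) :
    Idx d n × Feat nf → ℂ :=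
  fun x => ψ (fun a => fineIndex (x.1 a) (s a), x.2)

/-- Probability that the measured and controlled process, started at layer `r` in the unnormalized
branch state `ψ` with branch label `m`, ends with readout `z`.  The last layer is followed by the
measurement of the remaining index and feature registers (Born rule); every other layer is followed
by pooling, whose outcome is the branch label of the next layer.  Outcomes of all poolings are
marginalized. -/
def readoutFrom {d nl nf Q : ℕ}
    (V : (r : Fin Q) → Branch d Q r → Idx d (nl + r) → Matrix (Feat nf) (Feat nf) ℂ) :
    (r : ℕ) → (hr : r < Q) → Branch d Q r → (Idx d (nl + r) × Feat nf → ℂ) →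
      Idx d nl × Feat nf → ℝ
  | 0, hr, m, ψ, z => ‖(layer (V ⟨0, hr⟩ m)).mulVec ψ z‖ ^ 2
  | r + 1, hr, m, ψ, z =>
      ∑ s : Outcome d,
        readoutFrom V r (by omega) ⟨s, fun h => absurd hr (by omega)⟩
          (pool s ((layer (V ⟨r + 1, hr⟩ m)).mulVec ψ)) z

/-- The space of encoded inputs: the index register has `n_idx = nl + Q - 1` qubits per axis. -/
abbrev InputState (d nl nf Q : ℕ) : Type :=
  EuclideanSpace ℂ (Idx d (nl + (Q - 1)) × Feat nf)

/-- The readout distribution `p_Θ(z ∣ x)` of the depth-`Q` network, with `ψ` the encoded input. -/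
def readout {d nl nf Q : ℕ} (hQ : 1 ≤ Q) (Θ : Params d nl nf Q) (ψ : InputState d nl nf Q) :
    Idx d nl × Feat nf → ℝ :=
  readoutFrom (fun r m k => pauliExp fun α => Θ ⟨r, m, k, α⟩) (Q - 1) (by omega) ⟨0, fun _ => rfl⟩
    ψ.ofLp

def softmax {M : ℕ} (u : Fin M → ℝ) : Fin M → ℝ :=
  fun a => Real.exp (u a) / ∑ a', Real.exp (u a')

/-- Weights and biases `(W, b)` of the classical linear head. -/
abbrev Head (d nl nf M : ℕ) : Type := (Fin M → Idx d nl × Feat nf → ℝ) × (Fin M → ℝ)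

/-- The single-sample cross-entropy loss `-log q_c` with `q = softmax (W p_Θ(· ∣ x) + b)`. -/
def loss {d nl nf Q M : ℕ} (hQ : 1 ≤ Q) (Θ : Params d nl nf Q) (H : Head d nl nf M)
    (ψ : InputState d nl nf Q) (c : Fin M) : ℝ :=
  -Real.log (softmax ((Matrix.of H.1).mulVec (readout hQ Θ ψ) + H.2) c)

/-- The average loss over samples `(ψ i, c i)`, `i = 1, …, N`. -/
def avgLoss {d nl nf Q M N : ℕ} (hQ : 1 ≤ Q) (ψ : Fin N → InputState d nl nf Q)
    (c : Fin N → Fin M) (H : Head d nl nf M) (Θ : Params d nl nf Q) : ℝ :=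
  (1 / (N : ℝ)) * ∑ i, loss hQ Θ H (ψ i) (c i)

/-- The quantum gradient `G_Q` of the average loss. -/
def quantumGradient {d nl nf Q M N : ℕ} (hQ : 1 ≤ Q) (ψ : Fin N → InputState d nl nf Q)
    (c : Fin N → Fin M) (H : Head d nl nf M) (Θ : Params d nl nf Q) : Params d nl nf Q :=
  gradient (avgLoss hQ ψ c H) Θ

/-- The uniform distribution on the interval `(a, b)`. -/
def unif (a b : ℝ) : Measure ℝ := ProbabilityTheory.cond volume (Set.Ioo a b)

/-- Independent `Unif(0, 2π)` quantum coordinates. -/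
def quantumInit (d nl nf Q : ℕ) : Measure (Params d nl nf Q) :=
  (Measure.pi fun _ : Coord d nl nf Q => unif 0 (2 * Real.pi)).map (WithLp.toLp 2)

/-- The readout dimension `D_out = 2^(d n_l) 2^(n_f)`. -/
def outDim (d nl nf : ℕ) : ℕ := 2 ^ (d * nl) * 2 ^ nf

/-- Fan-in uniform head: all weights and biases independent, `Unif(-D_out^{-1/2}, D_out^{-1/2})`. -/
def headInit (d nl nf M : ℕ) : Measure (Head d nl nf M) :=
  let u : Measure ℝ :=
    unif (-(1 / Real.sqrt (outDim d nl nf))) (1 / Real.sqrt (outDim d nl nf))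
  (Measure.pi fun _ : Fin M => Measure.pi fun _ : Idx d nl × Feat nf => u).prod
    (Measure.pi fun _ : Fin M => u)

end PCSQCNN

end

open PCSQCNN

/-!
The gradient norm is bounded for every fixed parameter vector `Θ` by a multiple of the squared
Frobenius norm of the weight matrix, `‖G‖² ≤ 4 ⬝ 4^nf ⬝ Q ⬝ 2 ‖W‖²`
(`norm_sq_quantumGradient_le`).  Since the weights are centred with variance `1 / (3 D_out)`, the
expectation of `‖W‖²` is `M / 3` (`integral_sum_sq_weights`), and the law of `Θ` plays no role.

For one sample, the derivative of the cross-entropy at `Θ` is the derivative of the linear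
functional `g = Wᵀ (q - e_c)` of the readout, and `max g² ≤ 2 ‖W‖²` because `‖q - e_c‖² ≤ 2`; the
average over the samples does not increase the norm.  It remains to bound the squared gradient of
`∑ z, g z * p_Θ(z)` by `4 ⬝ 4^nf ⬝ Q ⬝ max g²`, which is done layer by layer
(`sum_sq_deriv_readout_le`).

Before layer `r` the process is an ensemble of unnormalized branch states `φ_j` with branch labels
`m_j`, whose squared norms add up to at most one.  In the Heisenberg picture the functional `g` is
the expectation of a Hermitian observable `A` of norm at most `max |g|` in the states `U φ_j` after the
layer, and `A` does not depend on the parameters of the layer (`exists_backward_observable`).  A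
coordinate `(m, k, α)` of the layer moves only the block of the Fourier mode `k` in branch `m`, and
the derivative of that block is a contraction because the matrix exponential is `1`-Lipschitz on
skew-adjoint matrices (`exists_hasDerivAt_pauliExp`).  So the partial derivative is at most
`2 ∑ ‖(F φ_j)_k‖ ‖(F A U φ_j)_k‖`, the sum being over the `j` with `m_j = m`.  By the Cauchy–Schwarz
inequality its square is at most four times `∑ ‖(F A U φ_j)_k‖²`, and by unitarity of the Fourier
transform `F` these quantities add up to at most `max g²` over all modes and branches
(`layerSqSum_ensemble_le`); the factor `4^nf` counts the Pauli strings.  Summing over modes and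
branches before estimating is what keeps the number of modes out of the bound.
-/

open MeasureTheory
open scoped Kronecker

namespace PCSQCNN

/-! ### Tensor products of matrices, Pauli strings and the Fourier transform -/

/-- The tensor product of a finite family of square matrices of the same size, in the product
basis. -/
noncomputable def tensorMatrix {ι κ : Type*} [Fintype ι] (A : ι → Matrix κ κ ℂ) :
    Matrix (ι → κ) (ι → κ) ℂ :=
  Matrix.of fun x y => ∏ i, A i (x i) (y i)

section Tensor

variable {ι κ : Type*} [Fintype ι]

lemma tensorMatrix_mul [DecidableEq ι] [Fintype κ] (A B : ι → Matrix κ κ ℂ) :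
    tensorMatrix A * tensorMatrix B = tensorMatrix fun i => A i * B i := by
  ext x z
  simp only [tensorMatrix, Matrix.mul_apply, Matrix.of_apply, ← Finset.prod_mul_distrib]
  rw [Finset.prod_univ_sum, Fintype.piFinset_univ]

lemma tensorMatrix_one [DecidableEq κ] : tensorMatrix (fun _ : ι => (1 : Matrix κ κ ℂ)) = 1 := by
  ext x y
  simp only [tensorMatrix, Matrix.of_apply, Matrix.one_apply]
  rw [Fintype.prod_ite_zero]
  simp [funext_iff]

lemma star_tensorMatrix (A : ι → Matrix κ κ ℂ) :
    star (tensorMatrix A) = tensorMatrix fun i => star (A i) := by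
  ext x y
  simp [tensorMatrix, Matrix.star_apply]

lemma tensorMatrix_mem_unitary [DecidableEq ι] [Fintype κ] [DecidableEq κ]
    {A : ι → Matrix κ κ ℂ} (hA : ∀ i, A i ∈ unitary (Matrix κ κ ℂ)) :
    tensorMatrix A ∈ unitary (Matrix (ι → κ) (ι → κ) ℂ) := by
  rw [Unitary.mem_iff, star_tensorMatrix, tensorMatrix_mul, tensorMatrix_mul]
  simp only [Unitary.star_mul_self_of_mem (hA _), Unitary.mul_star_self_of_mem (hA _),
    tensorMatrix_one, and_self]

end Tensor

lemma star_pauli (a : Fin 4) : star (pauli a) = pauli a := by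
  fin_cases a <;> ext i j <;> fin_cases i <;> fin_cases j <;> simp [pauli, Matrix.star_apply]

lemma pauli_mem_unitary (a : Fin 4) : pauli a ∈ unitary (Matrix (Fin 2) (Fin 2) ℂ) := by
  have h : pauli a * pauli a = 1 := by
    fin_cases a <;> ext i j <;> fin_cases i <;> fin_cases j <;>
      simp [pauli, Matrix.mul_apply]
  rw [Unitary.mem_iff, star_pauli]
  exact ⟨h, h⟩

lemma star_pauliString {nf : ℕ} (α : PauliString nf) : star (pauliString α) = pauliString α := by
  change star (tensorMatrix fun j => pauli (α j)) = tensorMatrix fun j => pauli (α j)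
  simp only [star_tensorMatrix, star_pauli]

lemma pauliString_mem_unitary {nf : ℕ} (α : PauliString nf) :
    pauliString α ∈ unitary (Matrix (Feat nf) (Feat nf) ℂ) :=
  tensorMatrix_mem_unitary fun j => pauli_mem_unitary (α j)

/-- The columns of the Fourier matrix are orthonormal: off the diagonal the inner product is a
full geometric sum over the powers of a nontrivial `N`-th root of unity. -/
lemma qft_mem_unitary (N : ℕ) : qft N ∈ unitary (Matrix (Fin N) (Fin N) ℂ) := by
  rcases Nat.eq_zero_or_pos N with rfl | hN
  · rw [Subsingleton.elim (qft 0) 1]; exact one_mem _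
  have hN' : (N : ℂ) ≠ 0 := by exact_mod_cast hN.ne'
  set ζ : ℂ := Complex.exp (2 * Real.pi * Complex.I / N) with hζ
  have hprim : IsPrimitiveRoot ζ N := Complex.isPrimitiveRoot_exp N hN.ne'
  have hζ0 : ζ ≠ 0 := Complex.exp_ne_zero _
  have hentry : ∀ k j, qft N k j = ((Real.sqrt N : ℝ) : ℂ)⁻¹ * ((ζ ^ (k : ℕ)) ^ (j : ℕ))⁻¹ := by
    intro k j
    simp only [qft, Matrix.of_apply]
    rw [hζ, ← Complex.exp_nat_mul, ← Complex.exp_nat_mul, ← Complex.exp_neg]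
    congr 2
    ring
  have hstar : (starRingEnd ℂ) ζ = ζ⁻¹ := by
    rw [hζ, ← Complex.exp_conj, ← Complex.exp_neg]
    congr 1
    simp [neg_div, Complex.conj_ofNat]
  have hsq : (((Real.sqrt N : ℝ) : ℂ)⁻¹) * ((Real.sqrt N : ℝ) : ℂ)⁻¹ = (N : ℂ)⁻¹ := by
    rw [← mul_inv, ← Complex.ofReal_mul, Real.mul_self_sqrt (Nat.cast_nonneg N)]
    simp
  have hmul : star (qft N) * qft N = 1 := by
    ext i j
    rw [Matrix.mul_apply]
    have hterm : ∀ k : Fin N, star (qft N) i k * qft N k j =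
        (N : ℂ)⁻¹ * (ζ ^ (i : ℕ) * (ζ ^ (j : ℕ))⁻¹) ^ (k : ℕ) := by
      intro k
      rw [Matrix.star_apply, hentry, hentry, ← hsq, mul_pow, inv_pow, ← pow_mul, ← pow_mul,
        ← pow_mul, ← pow_mul, mul_comm (k : ℕ) i, mul_comm (k : ℕ) j]
      simp only [RCLike.star_def, map_mul, map_inv₀, map_pow, hstar, Complex.conj_ofReal,
        inv_pow, inv_inv]
      ring
    simp only [hterm, ← Finset.mul_sum]
    rw [Fin.sum_univ_eq_sum_range fun k => (ζ ^ (i : ℕ) * (ζ ^ (j : ℕ))⁻¹) ^ k]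
    by_cases hij : i = j
    · subst hij
      simp [hζ0, hN']
    · rw [Matrix.one_apply_ne hij, geom_sum_eq]
      · rw [mul_pow, inv_pow, ← pow_mul, ← pow_mul, mul_comm (i : ℕ), mul_comm (j : ℕ), pow_mul,
          pow_mul, hprim.pow_eq_one]
        simp
      · intro h
        rw [mul_inv_eq_one₀ (pow_ne_zero _ hζ0)] at h
        exact hij (Fin.ext (hprim.pow_inj i.isLt j.isLt h))
  exact Unitary.mem_iff.2 ⟨hmul, mul_eq_one_comm.1 hmul⟩

lemma qftAxes_mem_unitary (d n : ℕ) :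
    qftAxes d n ∈ unitary (Matrix (Idx d n) (Idx d n) ℂ) :=
  tensorMatrix_mem_unitary fun _ => qft_mem_unitary _

/-! ### Squared norms and unitary matrices -/

/-- The squared Euclidean norm of a vector of amplitudes. -/
noncomputable def sqNorm {ι : Type*} [Fintype ι] (φ : ι → ℂ) : ℝ := ∑ i, ‖φ i‖ ^ 2

section SqNorm

variable {ι : Type*} [Fintype ι]

lemma sqNorm_nonneg (φ : ι → ℂ) : 0 ≤ sqNorm φ := Finset.sum_nonneg fun _ _ => sq_nonneg _

lemma star_dotProduct_self (φ : ι → ℂ) : star φ ⬝ᵥ φ = (sqNorm φ : ℂ) := by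
  simp only [dotProduct, sqNorm, Pi.star_apply, RCLike.star_def]
  push_cast
  exact Finset.sum_congr rfl fun i _ => Complex.conj_mul' (φ i)

lemma sqNorm_eq_norm_sq (φ : ι → ℂ) : sqNorm φ = ‖WithLp.toLp 2 φ‖ ^ 2 := by
  rw [EuclideanSpace.norm_sq_eq]; rfl

lemma norm_star_dotProduct_le (φ χ : ι → ℂ) :
    ‖star φ ⬝ᵥ χ‖ ≤ Real.sqrt (sqNorm φ) * Real.sqrt (sqNorm χ) := by
  have h := norm_inner_le_norm (𝕜 := ℂ) (WithLp.toLp 2 φ) (WithLp.toLp 2 χ)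
  rw [sqNorm_eq_norm_sq, sqNorm_eq_norm_sq, Real.sqrt_sq (norm_nonneg _),
    Real.sqrt_sq (norm_nonneg _)]
  rwa [EuclideanSpace.inner_eq_star_dotProduct, dotProduct_comm] at h

variable [DecidableEq ι]

lemma sqNorm_mulVec_of_mem_unitary {U : Matrix ι ι ℂ} (hU : U ∈ unitary (Matrix ι ι ℂ))
    (φ : ι → ℂ) : sqNorm (U.mulVec φ) = sqNorm φ := by
  have h : ((sqNorm (U.mulVec φ) : ℝ) : ℂ) = sqNorm φ := by
    rw [← star_dotProduct_self, ← star_dotProduct_self, Matrix.star_mulVec,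
      ← Matrix.dotProduct_mulVec, Matrix.mulVec_mulVec, ← Matrix.star_eq_conjTranspose,
      Unitary.star_mul_self_of_mem hU, Matrix.one_mulVec]
  exact_mod_cast h

open scoped Matrix.Norms.L2Operator in
lemma sqNorm_mulVec_le_of_norm_le_one {D : Matrix ι ι ℂ} (hD : ‖D‖ ≤ 1) (w : ι → ℂ) :
    sqNorm (D.mulVec w) ≤ sqNorm w := by
  have h := Matrix.l2_opNorm_mulVec D (WithLp.toLp 2 w)
  rw [sqNorm_eq_norm_sq, sqNorm_eq_norm_sq]
  refine pow_le_pow_left₀ (norm_nonneg _) (h.trans ?_) 2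
  exact mul_le_of_le_one_left (norm_nonneg _) hD

end SqNorm

/-! ### Exponentials of skew-adjoint elements -/

/-- The exponential is `1`-Lipschitz on the skew-adjoint elements: along the path
`s ↦ exp (s x) exp ((1 - s) y)` from `exp y` to `exp x` the derivative is `x - y` between two
unitaries. -/
lemma norm_exp_sub_exp_le {A : Type*} [NormedRing A] [NormedAlgebra ℝ A] [CompleteSpace A]
    [StarRing A] [CStarRing A] [StarModule ℝ A] [Nontrivial A] {x y : A}
    (hx : x ∈ skewAdjoint A) (hy : y ∈ skewAdjoint A) :
    ‖NormedSpace.exp x - NormedSpace.exp y‖ ≤ ‖x - y‖ := by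
  let _ : NormedAlgebra ℚ A := NormedAlgebra.restrictScalars ℚ ℝ A
  have hunit : ∀ z ∈ skewAdjoint A, ∀ s : ℝ, ‖NormedSpace.exp (s • z)‖ = 1 := fun z hz s =>
    CStarRing.norm_of_mem_unitary
      (NormedSpace.exp_mem_unitary_of_mem_skewAdjoint (skewAdjoint.smul_mem s hz))
  have hder : ∀ s : ℝ, HasDerivAt
      (fun s : ℝ => NormedSpace.exp (s • x) * NormedSpace.exp ((1 - s) • y))
      (NormedSpace.exp (s • x) * (x - y) * NormedSpace.exp ((1 - s) • y)) s := by
    intro s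
    have h1 := hasDerivAt_exp_smul_const x s
    have h2 := (hasDerivAt_exp_smul_const' y (1 - s)).scomp s ((hasDerivAt_id s).const_sub 1)
    refine (h1.mul h2).congr_deriv ?_
    simp only [Function.comp_apply, neg_smul, one_smul]
    noncomm_ring
  have h := norm_image_sub_le_of_norm_deriv_le_segment_01' (C := ‖x - y‖)
    (fun s _ => (hder s).hasDerivWithinAt) fun s _ => by
      refine (norm_mul_le _ _).trans ?_
      rw [hunit y hy, mul_one]
      refine (norm_mul_le _ _).trans ?_
      rw [hunit x hx, one_mul]
  simpa using h

lemma smul_sum_pauliString_mem_skewAdjoint {nf : ℕ} (θ : PauliString nf → ℝ) :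
    Complex.I • ∑ α, (θ α : ℂ) • pauliString α ∈
      skewAdjoint (Matrix (Feat nf) (Feat nf) ℂ) := by
  rw [skewAdjoint.mem_iff]
  simp [star_sum, star_smul, star_pauliString]

section

open scoped Matrix.Norms.L2Operator

lemma pauliExp_mem_unitary {nf : ℕ} (θ : PauliString nf → ℝ) :
    pauliExp θ ∈ unitary (Matrix (Feat nf) (Feat nf) ℂ) := by
  let _ : NormedAlgebra ℚ (Matrix (Feat nf) (Feat nf) ℂ) := NormedAlgebra.restrictScalars ℚ ℂ _
  exact NormedSpace.exp_mem_unitary_of_mem_skewAdjoint (smul_sum_pauliString_mem_skewAdjoint θ)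

lemma differentiable_pauliExp {nf : ℕ} :
    Differentiable ℝ (pauliExp : (PauliString nf → ℝ) → Matrix (Feat nf) (Feat nf) ℂ) := by
  intro θ
  have h1 : DifferentiableAt ℝ (NormedSpace.exp : Matrix (Feat nf) (Feat nf) ℂ → _)
      (Complex.I • ∑ α, (θ α : ℂ) • pauliString α) :=
    (NormedSpace.exp_analytic (𝕂 := ℝ) _).differentiableAt
  have h2 : DifferentiableAt ℝ
      (fun θ : PauliString nf → ℝ => Complex.I • ∑ α, (θ α : ℂ) • pauliString α) θ := by
    have h3 : ∀ α, DifferentiableAt ℝ (fun θ : PauliString nf → ℝ => (θ α : ℂ)) θ := fun α =>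
      (Complex.ofRealCLM.differentiableAt).comp θ (differentiableAt_apply α θ)
    have h4 : DifferentiableAt ℝ
        (fun θ : PauliString nf → ℝ => ∑ α, (θ α : ℂ) • pauliString α) θ :=
      DifferentiableAt.fun_sum fun α _ => (h3 α).smul_const _
    exact h4.const_smul Complex.I
  exact DifferentiableAt.comp θ h1 h2

lemma differentiable_pauliExp_apply {nf : ℕ} (x y : Feat nf) :
    Differentiable ℝ fun θ : PauliString nf → ℝ => pauliExp θ x y := by
  exact (LinearMap.toContinuousLinearMap (Matrix.entryLinearMap ℝ ℂ x y)).differentiable.comp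
    differentiable_pauliExp

/-- The derivative of a Pauli exponential in the direction of one coefficient is a contraction. -/
lemma exists_hasDerivAt_pauliExp {nf : ℕ} (θ : PauliString nf → ℝ) (α : PauliString nf) :
    ∃ D : Matrix (Feat nf) (Feat nf) ℂ,
      (∀ x y, HasDerivAt (fun t : ℝ => pauliExp (θ + t • Pi.single α 1) x y) (D x y) 0) ∧
      ∀ w, sqNorm (D.mulVec w) ≤ sqNorm w := by
  have hline : HasDerivAt (fun t : ℝ => θ + t • (Pi.single α 1 : PauliString nf → ℝ))
      (Pi.single α 1) 0 := by
    simpa using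
      ((hasDerivAt_id (0 : ℝ)).smul_const (Pi.single α 1 : PauliString nf → ℝ)).const_add θ
  have hdiff : DifferentiableAt ℝ
      (fun t : ℝ => pauliExp (θ + t • (Pi.single α 1 : PauliString nf → ℝ))) 0 :=
    (differentiable_pauliExp _).comp 0 hline.differentiableAt
  refine ⟨deriv (fun t : ℝ => pauliExp (θ + t • (Pi.single α 1 : PauliString nf → ℝ))) 0,
    fun x y => ?_, fun w => sqNorm_mulVec_le_of_norm_le_one ?_ w⟩
  · let entry := LinearMap.toContinuousLinearMap (Matrix.entryLinearMap ℝ ℂ x y)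
    exact entry.hasFDerivAt.comp_hasDerivAt 0 hdiff.hasDerivAt
  -- A Lipschitz constant of the curve bounds its derivative, without a formula for the latter.
  · refine norm_deriv_le_of_lip' zero_le_one (Filter.Eventually.of_forall fun t => ?_)
    refine (norm_exp_sub_exp_le (smul_sum_pauliString_mem_skewAdjoint _)
      (smul_sum_pauliString_mem_skewAdjoint _)).trans (le_of_eq ?_)
    have hsub : Complex.I • ∑ β, (((θ + t • (Pi.single α 1 : PauliString nf → ℝ)) β : ℝ) : ℂ) •
          pauliString β -
        Complex.I • ∑ β, (((θ + (0 : ℝ) • (Pi.single α 1 : PauliString nf → ℝ)) β : ℝ) : ℂ) •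
          pauliString β = (Complex.I * t) • pauliString α := by
      rw [← smul_sub, ← Finset.sum_sub_distrib, mul_smul]
      congr 1
      rw [Finset.sum_eq_single α]
      · simp [add_smul]
      · intro β _ hβ
        simp [Pi.single_eq_of_ne hβ]
      · simp
    rw [hsub, norm_smul, CStarRing.norm_of_mem_unitary (pauliString_mem_unitary α)]
    simp

end

/-! ### The Fourier multiplexer and the layers -/

section Layer

variable {d n nf : ℕ}

lemma multiplexer_apply (V : Idx d n → Matrix (Feat nf) (Feat nf) ℂ) (x y : Idx d n × Feat nf) :
    multiplexer V x y = if x.1 = y.1 then V x.1 x.2 y.2 else 0 := by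
  simp only [multiplexer, Matrix.sum_apply, Matrix.kroneckerMap_apply, Matrix.single_apply]
  rw [Finset.sum_eq_single x.1]
  · by_cases h : x.1 = y.1 <;> simp [h]
  · intro k _ hk
    simp [hk]
  · simp

lemma multiplexer_mulVec (V : Idx d n → Matrix (Feat nf) (Feat nf) ℂ)
    (φ : Idx d n × Feat nf → ℂ) (k : Idx d n) (f : Feat nf) :
    (multiplexer V).mulVec φ (k, f) = (V k).mulVec (fun g => φ (k, g)) f := by
  simp only [Matrix.mulVec, dotProduct, multiplexer_apply, Fintype.sum_prod_type, ite_mul, zero_mul]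
  rw [Finset.sum_eq_single k]
  · simp
  · intro l _ hl
    simp [hl.symm]
  · simp

lemma multiplexer_mul (V W : Idx d n → Matrix (Feat nf) (Feat nf) ℂ) :
    multiplexer V * multiplexer W = multiplexer fun k => V k * W k := by
  simp only [multiplexer, Finset.sum_mul_sum, ← Matrix.mul_kronecker_mul]
  refine Finset.sum_congr rfl fun k _ => ?_
  rw [Finset.sum_eq_single k]
  · rw [Matrix.single_mul_single_same, one_mul]
  · intro l _ hl
    rw [Matrix.single_mul_single_of_ne _ _ _ _ hl.symm, Matrix.zero_kronecker]
  · simp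

lemma star_multiplexer (V : Idx d n → Matrix (Feat nf) (Feat nf) ℂ) :
    star (multiplexer V) = multiplexer fun k => star (V k) := by
  simp only [multiplexer, star_sum, Matrix.star_eq_conjTranspose, Matrix.conjTranspose_kronecker,
    Matrix.conjTranspose_single, star_one]

lemma multiplexer_mem_unitary {V : Idx d n → Matrix (Feat nf) (Feat nf) ℂ}
    (hV : ∀ k, V k ∈ unitary (Matrix (Feat nf) (Feat nf) ℂ)) :
    multiplexer V ∈ unitary (Matrix (Idx d n × Feat nf) (Idx d n × Feat nf) ℂ) := by
  have h : star (multiplexer V) * multiplexer V = 1 := by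
    rw [star_multiplexer, multiplexer_mul]
    simp only [Unitary.star_mul_self_of_mem (hV _)]
    ext x y
    rw [multiplexer_apply, Matrix.one_apply, Matrix.one_apply, ← ite_and]
    simp only [Prod.ext_iff]
  exact Unitary.mem_iff.2 ⟨h, mul_eq_one_comm.1 h⟩

variable (d n nf) in
/-- The Fourier transform of the index register, acting trivially on the feature register. -/
noncomputable def qftFull : Matrix (Idx d n × Feat nf) (Idx d n × Feat nf) ℂ :=
  qftAxes d n ⊗ₖ (1 : Matrix (Feat nf) (Feat nf) ℂ)

variable (d n nf) in
lemma qftFull_mem_unitary :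
    qftFull d n nf ∈ unitary (Matrix (Idx d n × Feat nf) (Idx d n × Feat nf) ℂ) :=
  Matrix.kronecker_mem_unitary (qftAxes_mem_unitary d n) (one_mem _)

lemma layer_eq (V : Idx d n → Matrix (Feat nf) (Feat nf) ℂ) :
    layer V = star (qftFull d n nf) * multiplexer V * qftFull d n nf := by
  rw [layer, qftFull, Matrix.star_eq_conjTranspose, Matrix.conjTranspose_kronecker,
    Matrix.conjTranspose_one]

lemma layer_mem_unitary {V : Idx d n → Matrix (Feat nf) (Feat nf) ℂ}
    (hV : ∀ k, V k ∈ unitary (Matrix (Feat nf) (Feat nf) ℂ)) :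
    layer V ∈ unitary (Matrix (Idx d n × Feat nf) (Idx d n × Feat nf) ℂ) := by
  rw [layer_eq]
  exact mul_mem (mul_mem (Unitary.star_mem (qftFull_mem_unitary d n nf))
    (multiplexer_mem_unitary hV)) (qftFull_mem_unitary d n nf)

lemma sqNorm_eq_sum_modes (φ : Idx d n × Feat nf → ℂ) :
    sqNorm φ = ∑ k, sqNorm fun f => φ (k, f) := by
  simp only [sqNorm, Fintype.sum_prod_type]

end Layer

/-! ### Parity pooling -/

section Pool

variable {d n nf : ℕ}

/-- A fine index is a coarse index together with its least significant bit. -/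
def fineIndexEquiv (n : ℕ) : Fin (2 ^ n) × Fin 2 ≃ Fin (2 ^ (n + 1)) :=
  finProdFinEquiv.trans (finCongr (pow_succ 2 n).symm)

lemma fineIndex_eq (q : Fin (2 ^ n)) (s : Fin 2) : fineIndex q s = fineIndexEquiv n (q, s) := by
  ext
  simp [fineIndexEquiv, fineIndex, finProdFinEquiv, add_comm]

variable (d n nf) in
/-- The basis labels before a pooling step are the labels after it together with an outcome. -/
def poolEquiv : (Idx d n × Feat nf) × Outcome d ≃ Idx d (n + 1) × Feat nf where
  toFun p := (fun a => fineIndex (p.1.1 a) (p.2 a), p.1.2)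
  invFun x :=
    ((fun a => ((fineIndexEquiv n).symm (x.1 a)).1, x.2),
      fun a => ((fineIndexEquiv n).symm (x.1 a)).2)
  left_inv p := by
    simp [fineIndex_eq]
  right_inv x := by
    simp [fineIndex_eq]

lemma star_dotProduct_eq_sum_pool (φ χ : Idx d (n + 1) × Feat nf → ℂ) :
    star φ ⬝ᵥ χ = ∑ s, star (pool s φ) ⬝ᵥ pool s χ := by
  simp only [dotProduct]
  rw [← (poolEquiv d n nf).sum_comp, Fintype.sum_prod_type, Finset.sum_comm]
  rfl

lemma sqNorm_eq_sum_pool (φ : Idx d (n + 1) × Feat nf → ℂ) :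
    sqNorm φ = ∑ s, sqNorm (pool s φ) := by
  simp only [sqNorm]
  rw [← (poolEquiv d n nf).sum_comp, Fintype.sum_prod_type, Finset.sum_comm]
  rfl

/-- The operator that acts as `B s` on the part of the state with pooling outcome `s`. -/
def poolBlocks (B : Outcome d → Matrix (Idx d n × Feat nf) (Idx d n × Feat nf) ℂ) :
    Matrix (Idx d (n + 1) × Feat nf) (Idx d (n + 1) × Feat nf) ℂ :=
  (Matrix.blockDiagonal B).submatrix (poolEquiv d n nf).symm (poolEquiv d n nf).symm

lemma pool_poolBlocks_mulVec
    (B : Outcome d → Matrix (Idx d n × Feat nf) (Idx d n × Feat nf) ℂ) (s : Outcome d)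
    (φ : Idx d (n + 1) × Feat nf → ℂ) :
    pool s ((poolBlocks B).mulVec φ) = (B s).mulVec (pool s φ) := by
  ext x
  change (poolBlocks B).mulVec φ (poolEquiv d n nf (x, s)) = _
  simp only [poolBlocks, Matrix.mulVec, dotProduct, Matrix.submatrix_apply,
    Equiv.symm_apply_apply]
  rw [← (poolEquiv d n nf).sum_comp, Fintype.sum_prod_type]
  simp only [Equiv.symm_apply_apply, Matrix.blockDiagonal_apply, ite_mul, zero_mul,
    Finset.sum_ite_eq, Finset.mem_univ, if_true]
  rfl

lemma isHermitian_poolBlocks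
    {B : Outcome d → Matrix (Idx d n × Feat nf) (Idx d n × Feat nf) ℂ}
    (hB : ∀ s, (B s).IsHermitian) : (poolBlocks B).IsHermitian := by
  refine Matrix.IsHermitian.submatrix ?_ _
  rw [Matrix.IsHermitian, Matrix.blockDiagonal_conjTranspose]
  simp only [(hB _).eq]

end Pool

/-! ### Backward observables -/

/-- The blocks of all layers, as a function of the parameter vector. -/
noncomputable def blocks {d nl nf Q : ℕ} (Θ : Params d nl nf Q) (r : Fin Q) (m : Branch d Q r)
    (k : Idx d (nl + r)) : Matrix (Feat nf) (Feat nf) ℂ :=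
  pauliExp fun α => Θ ⟨r, m, k, α⟩

/-- In the Heisenberg picture, a linear functional `g` of the readout is the expectation of an
observable `A` in the state after layer `r`.  It is Hermitian, its operator norm is at most
`max |g|`, and it involves only the blocks of the layers after layer `r`. -/
lemma exists_backward_observable {d nl nf Q : ℕ}
    {V : (r : Fin Q) → Branch d Q r → Idx d (nl + r) → Matrix (Feat nf) (Feat nf) ℂ}
    (hV : ∀ r m k, V r m k ∈ unitary (Matrix (Feat nf) (Feat nf) ℂ))
    {g : Idx d nl × Feat nf → ℝ} {G : ℝ} (hg : ∀ z, g z ^ 2 ≤ G) :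
    ∀ (r : ℕ) (hr : r < Q),
      ∃ A : Matrix (Idx d (nl + r) × Feat nf) (Idx d (nl + r) × Feat nf) ℂ,
        A.IsHermitian ∧ (∀ φ, sqNorm (A.mulVec φ) ≤ G * sqNorm φ) ∧
        ∀ V' : (r : Fin Q) → Branch d Q r → Idx d (nl + r) → Matrix (Feat nf) (Feat nf) ℂ,
          (∀ r' : Fin Q, (r' : ℕ) < r → V' r' = V r') →
          ∀ (m : Branch d Q r) (φ : Idx d (nl + r) × Feat nf → ℂ),
            ((∑ z, g z * readoutFrom V' r hr m φ z : ℝ) : ℂ) =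
              star ((layer (V' ⟨r, hr⟩ m)).mulVec φ) ⬝ᵥ
                A.mulVec ((layer (V' ⟨r, hr⟩ m)).mulVec φ) := by
  intro r
  induction r with
  | zero =>
    intro hr
    refine ⟨Matrix.diagonal fun z => (g z : ℂ), ?_, ?_, ?_⟩
    · rw [Matrix.isHermitian_diagonal_iff]
      intro z
      simp [isSelfAdjoint_iff]
    · intro φ
      rw [sqNorm, sqNorm, Finset.mul_sum]
      refine Finset.sum_le_sum fun z _ => ?_
      rw [Matrix.mulVec_diagonal, norm_mul, mul_pow, Complex.norm_real, Real.norm_eq_abs, sq_abs]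
      exact mul_le_mul_of_nonneg_right (hg z) (sq_nonneg _)
    · intro V' _ m φ
      simp only [readoutFrom, dotProduct, Matrix.mulVec_diagonal, Pi.star_apply, RCLike.star_def]
      push_cast
      refine Finset.sum_congr rfl fun z _ => ?_
      rw [← Complex.conj_mul']
      ring
  | succ r ih =>
    intro hr
    obtain ⟨A, hA, hnorm, hval⟩ := ih (by omega)
    let m' : Outcome d → Branch d Q r := fun s => ⟨s, fun h => absurd hr (by omega)⟩
    let U : Outcome d → Matrix (Idx d (nl + r) × Feat nf) (Idx d (nl + r) × Feat nf) ℂ :=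
      fun s => layer (V ⟨r, by omega⟩ (m' s))
    have hU : ∀ s, U s ∈ unitary _ := fun s => layer_mem_unitary (hV ⟨r, _⟩ _)
    refine ⟨poolBlocks fun s => star (U s) * A * U s, ?_, ?_, ?_⟩
    · exact isHermitian_poolBlocks fun s => Matrix.isHermitian_conjTranspose_mul_mul (U s) hA
    · intro φ
      rw [sqNorm_eq_sum_pool, sqNorm_eq_sum_pool φ, Finset.mul_sum]
      refine Finset.sum_le_sum fun s _ => ?_
      rw [pool_poolBlocks_mulVec, ← Matrix.mulVec_mulVec, ← Matrix.mulVec_mulVec,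
        sqNorm_mulVec_of_mem_unitary (Unitary.star_mem (hU s))]
      refine (hnorm _).trans_eq ?_
      rw [sqNorm_mulVec_of_mem_unitary (hU s)]
    · intro V' hV' m φ
      have hpool : ∀ s, layer (V' ⟨r, by omega⟩ (m' s)) = U s := fun s => by
        rw [hV' ⟨r, by omega⟩ (Nat.lt_succ_self r)]
      rw [star_dotProduct_eq_sum_pool]
      simp only [pool_poolBlocks_mulVec, readoutFrom, Finset.mul_sum]
      rw [Finset.sum_comm, Complex.ofReal_sum]
      refine Finset.sum_congr rfl fun s _ => ?_
      rw [hval V' (fun r' h => hV' r' (by omega)) (m' s), hpool, Matrix.star_mulVec,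
        ← Matrix.dotProduct_mulVec, Matrix.mulVec_mulVec, Matrix.mulVec_mulVec,
        Matrix.star_eq_conjTranspose, Matrix.mul_assoc]

/-! ### Differentiability of the readout -/

section Differentiability

variable {d nl nf Q : ℕ}

lemma blocks_mem_unitary (Θ : Params d nl nf Q) (r : Fin Q) (m : Branch d Q r)
    (k : Idx d (nl + r)) : blocks Θ r m k ∈ unitary (Matrix (Feat nf) (Feat nf) ℂ) :=
  pauliExp_mem_unitary _

lemma differentiable_blocks_apply (r : Fin Q) (m : Branch d Q r) (k : Idx d (nl + r))
    (x y : Feat nf) : Differentiable ℝ fun Θ : Params d nl nf Q => blocks Θ r m k x y := by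
  have h : Differentiable ℝ
      fun (Θ : Params d nl nf Q) (α : PauliString nf) => Θ ⟨r, m, k, α⟩ :=
    differentiable_pi.2 fun α => differentiable_euclidean.1 differentiable_id _
  exact (differentiable_pauliExp_apply x y).comp h

lemma differentiable_mulVec_apply {E ι κ : Type*} [NormedAddCommGroup E] [NormedSpace ℝ E]
    [Fintype κ] {A : E → Matrix ι κ ℂ} {φ : E → κ → ℂ}
    (hA : ∀ i j, Differentiable ℝ fun t => A t i j) (hφ : ∀ j, Differentiable ℝ fun t => φ t j)
    (i : ι) : Differentiable ℝ fun t => (A t).mulVec (φ t) i := by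
  simp only [Matrix.mulVec, dotProduct]
  exact Differentiable.fun_sum fun j _ => (hA i j).mul (hφ j)

lemma differentiable_layer_mulVec_apply {E : Type*} [NormedAddCommGroup E] [NormedSpace ℝ E]
    {n : ℕ} {V : E → Idx d n → Matrix (Feat nf) (Feat nf) ℂ}
    {φ : E → Idx d n × Feat nf → ℂ} (hV : ∀ k x y, Differentiable ℝ fun t => V t k x y)
    (hφ : ∀ x, Differentiable ℝ fun t => φ t x) (x : Idx d n × Feat nf) :
    Differentiable ℝ fun t => (layer (V t)).mulVec (φ t) x := by
  simp only [layer_eq, ← Matrix.mulVec_mulVec]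
  refine differentiable_mulVec_apply (A := fun _ => star (qftFull d n nf))
    (fun _ _ => differentiable_const _) (fun y => ?_) x
  refine differentiable_mulVec_apply (fun i j => ?_) (fun z => ?_) y
  · simp only [multiplexer_apply]
    split_ifs
    · exact hV _ _ _
    · exact differentiable_const _
  · exact differentiable_mulVec_apply (A := fun _ => qftFull d n nf)
      (fun _ _ => differentiable_const _) hφ z

lemma differentiable_readoutFrom {E : Type*} [NormedAddCommGroup E] [NormedSpace ℝ E]
    {V : E → (r : Fin Q) → Branch d Q r → Idx d (nl + r) → Matrix (Feat nf) (Feat nf) ℂ}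
    (hV : ∀ r m k x y, Differentiable ℝ fun t => V t r m k x y) (z : Idx d nl × Feat nf) :
    ∀ (r : ℕ) (hr : r < Q) (m : Branch d Q r) (φ : E → Idx d (nl + r) × Feat nf → ℂ),
      (∀ x, Differentiable ℝ fun t => φ t x) →
      Differentiable ℝ fun t => readoutFrom (V t) r hr m (φ t) z := by
  intro r
  induction r with
  | zero =>
    intro hr m φ hφ
    exact (differentiable_layer_mulVec_apply (hV ⟨0, hr⟩ m) hφ z).norm_sq ℝ
  | succ r ih =>
    intro hr m φ hφ
    simp only [readoutFrom]
    exact Differentiable.fun_sum fun s _ => ih _ _ _ fun x =>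
      differentiable_layer_mulVec_apply (hV ⟨r + 1, hr⟩ m) hφ _

lemma differentiable_readout (hQ : 1 ≤ Q) (ψ : InputState d nl nf Q) (z : Idx d nl × Feat nf) :
    Differentiable ℝ fun Θ : Params d nl nf Q => readout hQ Θ ψ z :=
  differentiable_readoutFrom (V := blocks) differentiable_blocks_apply z _ _ _ _
    fun _ => differentiable_const _

end Differentiability

/-! ### Partial derivatives of the readout -/

/-- The derivative of the expectation of a Hermitian observable along a curve of states. -/
lemma hasDerivAt_re_star_dotProduct_mulVec {ι : Type*} [Fintype ι] {A : Matrix ι ι ℂ}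
    (hA : A.IsHermitian) {φ : ℝ → ι → ℂ} {φ' : ι → ℂ} {t : ℝ}
    (hφ : ∀ i, HasDerivAt (fun s => φ s i) (φ' i) t) :
    HasDerivAt (fun s => (star (φ s) ⬝ᵥ A.mulVec (φ s)).re)
      (2 * (star φ' ⬝ᵥ A.mulVec (φ t)).re) t := by
  have hmul : ∀ i, HasDerivAt (fun s => A.mulVec (φ s) i) (A.mulVec φ' i) t := fun i =>
    HasDerivAt.fun_sum fun j _ => (hφ j).const_mul (A i j)
  have hdot : HasDerivAt (fun s => star (φ s) ⬝ᵥ A.mulVec (φ s))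
      (star φ' ⬝ᵥ A.mulVec (φ t) + star (φ t) ⬝ᵥ A.mulVec φ') t := by
    rw [dotProduct, dotProduct, ← Finset.sum_add_distrib]
    exact HasDerivAt.fun_sum fun i _ => ((hφ i).star).mul (hmul i)
  have hsymm : (star (φ t) ⬝ᵥ A.mulVec φ').re = (star φ' ⬝ᵥ A.mulVec (φ t)).re := by
    have h : star (star φ' ⬝ᵥ A.mulVec (φ t)) = star (φ t) ⬝ᵥ A.mulVec φ' := by
      rw [← Matrix.star_dotProduct_star, star_star, Matrix.star_mulVec, hA.eq,
        ← Matrix.dotProduct_mulVec]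
    rw [← h]
    simp
  have hre := Complex.reCLM.hasFDerivAt.comp_hasDerivAt t hdot
  refine hre.congr_deriv ?_
  simp only [Complex.reCLM_apply, Complex.add_re, hsymm]
  ring

section Partial

variable {d nl nf Q : ℕ}

lemma blocks_add_single_of_ne (Θ : Params d nl nf Q) (e : Coord d nl nf Q) (t : ℝ) {r : Fin Q}
    {m : Branch d Q r} {k : Idx d (nl + r)}
    (h : ∀ α, (⟨r, m, k, α⟩ : Coord d nl nf Q) ≠ e) :
    blocks (Θ + t • EuclideanSpace.single e 1) r m k = blocks Θ r m k := by
  simp [blocks, h]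

lemma blocks_add_single_self (Θ : Params d nl nf Q) (t : ℝ) (r : Fin Q)
    (m : Branch d Q r) (k : Idx d (nl + r)) (α : PauliString nf) :
    blocks (Θ + t • EuclideanSpace.single (⟨r, m, k, α⟩ : Coord d nl nf Q) 1) r m k =
      pauliExp ((fun β => Θ ⟨r, m, k, β⟩) + t • Pi.single α 1) := by
  rw [blocks]
  congr 1
  ext β
  simp [Pi.single_apply]

/-- Moving one coordinate of a layer moves the image of a state by a vector supported on the
corresponding Fourier mode, and not at all in the other branches.  Hence the pairing of this
velocity with any vector `χ` involves only the components of the two vectors in that mode. -/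
lemma exists_hasDerivAt_layer_mulVec (Θ : Params d nl nf Q) (r : Fin Q) (m : Branch d Q r)
    (k : Idx d (nl + r)) (α : PauliString nf) (m' : Branch d Q r)
    (φ : Idx d (nl + r) × Feat nf → ℂ) :
    ∃ w : Idx d (nl + r) × Feat nf → ℂ,
      (∀ x, HasDerivAt (fun t : ℝ => (layer (blocks (Θ + t •
        EuclideanSpace.single (⟨r, m, k, α⟩ : Coord d nl nf Q) 1) r m')).mulVec φ x) (w x) 0) ∧
      ∀ χ, |2 * (star w ⬝ᵥ χ).re| ≤ if m' = m then
        2 * (Real.sqrt (sqNorm fun f => (qftFull d (nl + r) nf).mulVec φ (k, f)) *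
          Real.sqrt (sqNorm fun f => (qftFull d (nl + r) nf).mulVec χ (k, f))) else 0 := by
  by_cases hm : m' = m
  · subst hm
    obtain ⟨D, hD, hle⟩ := exists_hasDerivAt_pauliExp (fun β => Θ ⟨r, m', k, β⟩) α
    set F := qftFull d (nl + r) nf with hF
    set v : Idx d (nl + r) × Feat nf → ℂ := fun x =>
      if x.1 = k then D.mulVec (fun f => F.mulVec φ (k, f)) x.2 else 0 with hv
    have hmux : ∀ x, HasDerivAt (fun t : ℝ => (multiplexer (blocks (Θ + t •
        EuclideanSpace.single (⟨r, m', k, α⟩ : Coord d nl nf Q) 1) r m')).mulVec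
          (F.mulVec φ) x) (v x) 0 := by
      rintro ⟨l, f⟩
      simp only [multiplexer_mulVec, hv]
      by_cases hl : l = k
      · subst hl
        simp only [if_true, blocks_add_single_self]
        exact HasDerivAt.fun_sum fun g _ => (hD f g).mul_const _
      · have hconst : ∀ t : ℝ, blocks (Θ + t •
            EuclideanSpace.single (⟨r, m', k, α⟩ : Coord d nl nf Q) 1) r m' l =
              blocks Θ r m' l := fun t =>
          blocks_add_single_of_ne _ _ _ fun β h => hl (by simp at h; exact h.1)
        simp only [hconst, if_neg hl]
        exact hasDerivAt_const _ _
    refine ⟨(star F).mulVec v, fun x => ?_, fun χ => ?_⟩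
    · simp only [layer_eq, ← Matrix.mulVec_mulVec]
      exact HasDerivAt.fun_sum fun y _ => (hmux y).const_mul _
    · rw [if_pos rfl, Matrix.star_mulVec, ← Matrix.dotProduct_mulVec,
        Matrix.star_eq_conjTranspose, Matrix.conjTranspose_conjTranspose]
      have hdot : star v ⬝ᵥ F.mulVec χ =
          star (D.mulVec fun f => F.mulVec φ (k, f)) ⬝ᵥ fun f => F.mulVec χ (k, f) := by
        simp only [dotProduct, Fintype.sum_prod_type, hv, Pi.star_apply]
        rw [Finset.sum_eq_single k]
        · simp
        · intro l _ hl
          simp [hl]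
        · simp
      rw [hdot, abs_mul, abs_two]
      refine mul_le_mul_of_nonneg_left ?_ zero_le_two
      refine (Complex.abs_re_le_norm _).trans ((norm_star_dotProduct_le _ _).trans ?_)
      exact mul_le_mul_of_nonneg_right (Real.sqrt_le_sqrt (hle _)) (Real.sqrt_nonneg _)
  · refine ⟨0, fun x => ?_, fun χ => by simp [hm]⟩
    have hconst : ∀ t : ℝ, blocks (Θ + t •
        EuclideanSpace.single (⟨r, m, k, α⟩ : Coord d nl nf Q) 1) r m' = blocks Θ r m' := fun t => by
      ext1 l
      exact blocks_add_single_of_ne _ _ _ fun β h => hm (by simp at h; exact h.1)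
    simp only [hconst]
    exact hasDerivAt_const _ _

/-- The sum of the squared partial derivatives of `f` over the coordinates of layer `r`. -/
noncomputable def layerSqSum (f : Params d nl nf Q → ℝ) (Θ : Params d nl nf Q) (r : Fin Q) : ℝ :=
  ∑ p : Branch d Q r × Idx d (nl + r) × PauliString nf,
    deriv (fun t : ℝ => f (Θ + t •
      EuclideanSpace.single (⟨r, p⟩ : Coord d nl nf Q) 1)) 0 ^ 2

/-- The Cauchy–Schwarz step over an ensemble `J`, of which only the members in `p` contribute. -/
lemma sq_sum_le_four_mul_sum {J : Type*} [Fintype J] {p : J → Prop} [DecidablePred p]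
    {a b c : J → ℝ} (ha : ∀ j, 0 ≤ a j) (hb : ∀ j, 0 ≤ b j) (hsum : ∑ j, a j ≤ 1)
    (hc : ∀ j, |c j| ≤ if p j then 2 * (√(a j) * √(b j)) else 0) :
    (∑ j, c j) ^ 2 ≤ 4 * ∑ j, if p j then b j else 0 := by
  set b' : J → ℝ := fun j => if p j then b j else 0 with hb'
  have hb'0 : ∀ j, 0 ≤ b' j := fun j => by
    simp only [hb']; split_ifs; exacts [hb j, le_rfl]
  have habs : |∑ j, c j| ≤ 2 * ∑ j, √(a j) * √(b' j) := by
    rw [Finset.mul_sum]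
    refine (Finset.abs_sum_le_sum_abs _ _).trans (Finset.sum_le_sum fun j _ => ?_)
    refine (hc j).trans_eq ?_
    simp only [hb']
    split_ifs <;> simp
  have hcs : (∑ j, √(a j) * √(b' j)) ^ 2 ≤ (∑ j, a j) * ∑ j, b' j := by
    refine (Finset.sum_mul_sq_le_sq_mul_sq _ _ _).trans_eq ?_
    simp only [Real.sq_sqrt (ha _), Real.sq_sqrt (hb'0 _)]
  have hb'sum : 0 ≤ ∑ j, b' j := Finset.sum_nonneg fun j _ => hb'0 j
  rw [← sq_abs]
  refine (pow_le_pow_left₀ (abs_nonneg _) habs 2).trans ?_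
  rw [mul_pow]
  linarith [mul_le_mul_of_nonneg_right hsum hb'sum]

lemma sum_sum_sum_fiber {J B K : Type*} [Fintype J] [Fintype B] [Fintype K] [DecidableEq B]
    (m : J → B) (b : J → K → ℝ) :
    ∑ μ, ∑ k, ∑ j, (if m j = μ then b j k else 0) = ∑ j, ∑ k, b j k := by
  have h : ∀ μ, ∑ k, ∑ j, (if m j = μ then b j k else 0) =
      ∑ j, if m j = μ then ∑ k, b j k else 0 := fun μ => by
    rw [Finset.sum_comm]
    refine Finset.sum_congr rfl fun j _ => ?_
    split_ifs <;> simp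
  simp only [h]
  rw [Finset.sum_comm]
  simp

/-- One partial derivative of an ensemble average, at the first active layer.  The state of a member
of the ensemble enters through its weight in the Fourier mode of the coordinate, and so does the
backward state, which is the image under the observable `A` of the state after the layer. -/
lemma sq_deriv_ensemble_le (Θ : Params d nl nf Q) {g : Idx d nl × Feat nf → ℝ} (r : Fin Q)
    {A : Matrix (Idx d (nl + r) × Feat nf) (Idx d (nl + r) × Feat nf) ℂ} (hA : A.IsHermitian)
    (hval : ∀ Θ' : Params d nl nf Q, (∀ r' : Fin Q, r' < r → blocks Θ' r' = blocks Θ r') →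
      ∀ (m : Branch d Q r) (φ : Idx d (nl + r) × Feat nf → ℂ),
        ((∑ z, g z * readoutFrom (blocks Θ') r r.2 m φ z : ℝ) : ℂ) =
          star ((layer (blocks Θ' r m)).mulVec φ) ⬝ᵥ
            A.mulVec ((layer (blocks Θ' r m)).mulVec φ))
    {J : Type} [Fintype J] (m : J → Branch d Q r) (φ : J → Idx d (nl + r) × Feat nf → ℂ)
    (μ : Branch d Q r) (k : Idx d (nl + r)) (α : PauliString nf)
    (hφ : ∑ j, sqNorm (fun f => (qftFull d (nl + r) nf).mulVec (φ j) (k, f)) ≤ 1) :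
    deriv (fun t : ℝ => ∑ j, ∑ z, g z * readoutFrom (blocks (Θ + t •
      EuclideanSpace.single (⟨r, μ, k, α⟩ : Coord d nl nf Q) 1)) r r.2 (m j) (φ j) z) 0 ^ 2 ≤
    4 * ∑ j, if m j = μ then sqNorm (fun f => (qftFull d (nl + r) nf).mulVec
      (A.mulVec ((layer (blocks Θ r (m j))).mulVec (φ j))) (k, f)) else 0 := by
  choose w hw hwle using fun j => exists_hasDerivAt_layer_mulVec Θ r μ k α (m j) (φ j)
  have hre : ∀ t : ℝ, (∑ j, ∑ z, g z * readoutFrom (blocks (Θ + t •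
      EuclideanSpace.single (⟨r, μ, k, α⟩ : Coord d nl nf Q) 1)) r r.2 (m j) (φ j) z) =
      ∑ j, (star ((layer (blocks (Θ + t • EuclideanSpace.single
          (⟨r, μ, k, α⟩ : Coord d nl nf Q) 1) r (m j))).mulVec (φ j)) ⬝ᵥ
        A.mulVec ((layer (blocks (Θ + t • EuclideanSpace.single
          (⟨r, μ, k, α⟩ : Coord d nl nf Q) 1) r (m j))).mulVec (φ j))).re := by
    intro t
    refine Finset.sum_congr rfl fun j _ => ?_
    rw [← hval, Complex.ofReal_re]
    intro r' hr'
    ext1 m'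
    ext1 k'
    refine blocks_add_single_of_ne _ _ _ fun β h => ?_
    exact hr'.ne (congrArg (fun c : Coord d nl nf Q => c.1) h)
  have hderiv : HasDerivAt (fun t : ℝ => ∑ j, ∑ z, g z * readoutFrom (blocks (Θ + t •
      EuclideanSpace.single (⟨r, μ, k, α⟩ : Coord d nl nf Q) 1)) r r.2 (m j) (φ j) z)
      (∑ j, 2 * (star (w j) ⬝ᵥ A.mulVec ((layer (blocks Θ r (m j))).mulVec (φ j))).re) 0 := by
    simp only [hre]
    refine HasDerivAt.fun_sum fun j _ => ?_
    have h := hasDerivAt_re_star_dotProduct_mulVec hA (hw j)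
    simp only [zero_smul, add_zero] at h
    exact h
  rw [hderiv.deriv]
  exact sq_sum_le_four_mul_sum (fun j => sqNorm_nonneg _) (fun j => sqNorm_nonneg _) hφ
    fun j => hwle j _

/-- Bound for the first active layer of an ensemble of branch states.  One squared partial
derivative is at most `4` times the weight of the ensemble in the mode times the weight of the
backward states in the mode and branch; the latter weights add up to at most `G` over all modes and
branches. -/
lemma layerSqSum_ensemble_le (Θ : Params d nl nf Q) {g : Idx d nl × Feat nf → ℝ} {G : ℝ}
    (hg : ∀ z, g z ^ 2 ≤ G) (r : Fin Q) {J : Type} [Fintype J] (m : J → Branch d Q r)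
    (φ : J → Idx d (nl + r) × Feat nf → ℂ) (hφ : ∑ j, sqNorm (φ j) ≤ 1) :
    layerSqSum (fun Θ' => ∑ j, ∑ z, g z * readoutFrom (blocks Θ') r r.2 (m j) (φ j) z) Θ r ≤
      4 * 4 ^ nf * G := by
  have hG : 0 ≤ G := (sq_nonneg _).trans (hg ((fun _ => 0), fun _ => 0))
  obtain ⟨A, hA, hnorm, hval⟩ := exists_backward_observable (blocks_mem_unitary Θ) hg r r.2
  have hFu := qftFull_mem_unitary d (nl + r) nf
  have hmode : ∀ k, ∑ j, sqNorm (fun f => (qftFull d (nl + r) nf).mulVec (φ j) (k, f)) ≤ 1 :=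
    fun k => by
      refine (Finset.sum_le_sum fun j _ => ?_).trans hφ
      rw [← sqNorm_mulVec_of_mem_unitary hFu (φ j), sqNorm_eq_sum_modes]
      exact Finset.single_le_sum
        (f := fun l => sqNorm fun f => (qftFull d (nl + r) nf).mulVec (φ j) (l, f))
        (fun l _ => sqNorm_nonneg _) (Finset.mem_univ k)
  set b : J → Idx d (nl + r) → ℝ := fun j k => sqNorm fun f => (qftFull d (nl + r) nf).mulVec
    (A.mulVec ((layer (blocks Θ r (m j))).mulVec (φ j))) (k, f) with hb
  have hbsum : ∀ j, ∑ k, b j k ≤ G * sqNorm (φ j) := fun j => by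
    rw [hb, ← sqNorm_eq_sum_modes, sqNorm_mulVec_of_mem_unitary hFu]
    refine (hnorm _).trans_eq ?_
    rw [sqNorm_mulVec_of_mem_unitary (layer_mem_unitary (blocks_mem_unitary Θ r (m j)))]
  have hpart := fun (μ : Branch d Q r) (k : Idx d (nl + r)) (α : PauliString nf) =>
    sq_deriv_ensemble_le Θ r hA (fun Θ' h => hval (blocks Θ') h) m φ μ k α (hmode k)
  have hcard : ((Finset.univ : Finset (PauliString nf)).card : ℝ) = 4 ^ nf := by simp
  calc _ = ∑ μ : Branch d Q r, ∑ k : Idx d (nl + r), ∑ α : PauliString nf,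
        deriv (fun t : ℝ => ∑ j, ∑ z, g z * readoutFrom (blocks (Θ + t •
          EuclideanSpace.single (⟨r, μ, k, α⟩ : Coord d nl nf Q) 1)) r r.2 (m j) (φ j) z) 0 ^ 2 := by
        rw [layerSqSum, Fintype.sum_prod_type]
        simp only [Fintype.sum_prod_type]
    _ ≤ ∑ μ : Branch d Q r, ∑ k : Idx d (nl + r), ∑ _α : PauliString nf,
        4 * ∑ j, (if m j = μ then b j k else 0) :=
        Finset.sum_le_sum fun μ _ => Finset.sum_le_sum fun k _ => Finset.sum_le_sum fun α _ =>
          hpart μ k α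
    _ = 4 * 4 ^ nf * ∑ μ, ∑ k, ∑ j, (if m j = μ then b j k else 0) := by
        simp only [Finset.sum_const, hcard, nsmul_eq_mul, Finset.mul_sum, mul_assoc,
          mul_left_comm (4 : ℝ)]
    _ ≤ 4 * 4 ^ nf * (G * 1) := by
        refine mul_le_mul_of_nonneg_left ?_ (by positivity)
        rw [sum_sum_sum_fiber]
        refine (Finset.sum_le_sum fun j _ => hbsum j).trans ?_
        rw [← Finset.mul_sum]
        exact mul_le_mul_of_nonneg_left hφ hG
    _ = 4 * 4 ^ nf * G := by rw [mul_one]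

/-- The bound of `layerSqSum_ensemble_le` for all layers: passing one layer and the pooling after it
turns an ensemble of branch states into another one of the same total weight. -/
lemma layerSqSum_le_of_le (Θ : Params d nl nf Q) {g : Idx d nl × Feat nf → ℝ} {G : ℝ}
    (hg : ∀ z, g z ^ 2 ≤ G) :
    ∀ (r : ℕ) (hr : r < Q) (J : Type) [Fintype J] (m : J → Branch d Q r)
      (φ : J → Idx d (nl + r) × Feat nf → ℂ), ∑ j, sqNorm (φ j) ≤ 1 →
      ∀ r' : Fin Q, (r' : ℕ) ≤ r →
        layerSqSum (fun Θ' => ∑ j, ∑ z, g z * readoutFrom (blocks Θ') r hr (m j) (φ j) z) Θ r' ≤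
          4 * 4 ^ nf * G := by
  intro r
  induction r with
  | zero =>
    intro hr J _ m φ hφ r' hr'
    obtain rfl : r' = ⟨0, hr⟩ := Fin.ext (Nat.le_zero.1 hr')
    exact layerSqSum_ensemble_le Θ hg ⟨_, hr⟩ m φ hφ
  | succ r ih =>
    intro hr J _ m φ hφ r' hr'
    rcases hr'.eq_or_lt with h | h
    · obtain rfl : r' = ⟨r + 1, hr⟩ := Fin.ext h
      exact layerSqSum_ensemble_le Θ hg ⟨_, hr⟩ m φ hφ
    · let m' : J × Outcome d → Branch d Q r := fun p => ⟨p.2, fun h => absurd hr (by omega)⟩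
      let φ' : J × Outcome d → Idx d (nl + r) × Feat nf → ℂ := fun p =>
        pool p.2 ((layer (blocks Θ ⟨r + 1, hr⟩ (m p.1))).mulVec (φ p.1))
      have hφ' : ∑ p, sqNorm (φ' p) ≤ 1 := by
        rw [Fintype.sum_prod_type]
        refine (Finset.sum_le_sum fun j _ => ?_).trans hφ
        rw [← sqNorm_mulVec_of_mem_unitary
          (layer_mem_unitary (blocks_mem_unitary Θ ⟨r + 1, hr⟩ (m j))) (φ j), sqNorm_eq_sum_pool]
      refine le_trans (le_of_eq ?_)
        (ih (by omega) (J × Outcome d) m' φ' hφ' r' (Nat.lt_succ_iff.1 h))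
      rw [layerSqSum, layerSqSum]
      refine Finset.sum_congr rfl fun p _ => ?_
      congr 2
      ext t
      have hconst : blocks (Θ + t • EuclideanSpace.single (⟨r', p⟩ : Coord d nl nf Q) 1)
          ⟨r + 1, hr⟩ = blocks Θ ⟨r + 1, hr⟩ := by
        ext1 μ
        ext1 k
        refine blocks_add_single_of_ne _ _ _ fun β hβ => ?_
        have h' := congrArg (fun c : Coord d nl nf Q => (c.1 : ℕ)) hβ
        simp only at h'
        omega
      rw [Fintype.sum_prod_type]
      refine Finset.sum_congr rfl fun j _ => ?_
      simp only [readoutFrom, hconst, Finset.mul_sum]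
      rw [Finset.sum_comm]

/-- The squared gradient of a linear functional `g` of the readout is at most
`4 ⬝ 4^nf ⬝ Q ⬝ max g ^ 2`. -/
lemma sum_sq_deriv_readout_le (hQ : 1 ≤ Q) (Θ : Params d nl nf Q) {ψ : InputState d nl nf Q}
    (hψ : ‖ψ‖ = 1) {g : Idx d nl × Feat nf → ℝ} {G : ℝ} (hg : ∀ z, g z ^ 2 ≤ G) :
    ∑ e : Coord d nl nf Q,
      deriv (fun t : ℝ => ∑ z, g z * readout hQ (Θ + t • EuclideanSpace.single e 1) ψ z) 0 ^ 2 ≤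
      4 * 4 ^ nf * Q * G := by
  have h : ∀ r : Fin Q, layerSqSum (fun Θ' => ∑ z, g z * readout hQ Θ' ψ z) Θ r ≤
      4 * 4 ^ nf * G := fun r => by
    have hone : ∑ _j : Unit, sqNorm ψ.ofLp ≤ 1 := by
      simp [sqNorm_eq_norm_sq, hψ]
    have h := layerSqSum_le_of_le Θ hg (Q - 1) (by omega) Unit
      (fun _ => ⟨0, fun _ => rfl⟩) (fun _ => ψ.ofLp) hone r (by omega)
    simp only [Finset.univ_unique, Finset.sum_singleton] at h
    exact h
  calc _ = ∑ r : Fin Q, layerSqSum (fun Θ' => ∑ z, g z * readout hQ Θ' ψ z) Θ r := by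
        rw [Fintype.sum_sigma]; rfl
    _ ≤ ∑ _r : Fin Q, 4 * 4 ^ nf * G := Finset.sum_le_sum fun r _ => h r
    _ = 4 * 4 ^ nf * Q * G := by
        rw [Finset.sum_const, Finset.card_univ, Fintype.card_fin, nsmul_eq_mul]; ring

end Partial

/-! ### The gradient of the cross-entropy loss -/

section Loss

variable {d nl nf Q M N : ℕ}

/-- The logits `W p + b` of the head. -/
def logits (H : Head d nl nf M) (p : Idx d nl × Feat nf → ℝ) (a : Fin M) : ℝ :=
  ∑ z, H.1 a z * p z + H.2 a

lemma sum_exp_pos (u : Fin M → ℝ) (c : Fin M) : 0 < ∑ a, Real.exp (u a) :=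
  Finset.sum_pos (fun _ _ => Real.exp_pos _) ⟨c, Finset.mem_univ c⟩

lemma loss_eq (hQ : 1 ≤ Q) (Θ : Params d nl nf Q) (H : Head d nl nf M)
    (ψ : InputState d nl nf Q) (c : Fin M) :
    loss hQ Θ H ψ c = Real.log (∑ a, Real.exp (logits H (readout hQ Θ ψ) a)) -
      logits H (readout hQ Θ ψ) c := by
  change -Real.log (Real.exp (logits H (readout hQ Θ ψ) c) /
    ∑ a, Real.exp (logits H (readout hQ Θ ψ) a)) = _
  rw [Real.log_div (Real.exp_ne_zero _) (sum_exp_pos _ c).ne', Real.log_exp]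
  ring

lemma differentiable_loss (hQ : 1 ≤ Q) (H : Head d nl nf M) (ψ : InputState d nl nf Q)
    (c : Fin M) : Differentiable ℝ fun Θ => loss hQ Θ H ψ c := by
  have hlog : ∀ a, Differentiable ℝ fun Θ => logits H (readout hQ Θ ψ) a := fun a =>
    (Differentiable.fun_sum fun z _ => (differentiable_readout hQ ψ z).const_mul _).add_const _
  simp only [loss_eq]
  exact ((Differentiable.fun_sum fun a _ => (hlog a).exp).log
    fun Θ => (sum_exp_pos _ c).ne').sub (hlog c)

lemma differentiable_avgLoss (hQ : 1 ≤ Q) (ψ : Fin N → InputState d nl nf Q)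
    (c : Fin N → Fin M) (H : Head d nl nf M) : Differentiable ℝ (avgLoss hQ ψ c H) :=
  (Differentiable.fun_sum fun i _ => differentiable_loss hQ H (ψ i) (c i)).const_mul _

lemma continuous_uncurry_avgLoss (hQ : 1 ≤ Q) (ψ : Fin N → InputState d nl nf Q)
    (c : Fin N → Fin M) :
    Continuous (Function.uncurry fun (H : Head d nl nf M) Θ => avgLoss hQ ψ c H Θ) := by
  have hlog : ∀ i a, Continuous fun p : Head d nl nf M × Params d nl nf Q =>
      logits p.1 (readout hQ p.2 (ψ i)) a := fun i a => by
    have hread : ∀ z, Continuous fun p : Head d nl nf M × Params d nl nf Q =>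
        readout hQ p.2 (ψ i) z := fun z =>
      (differentiable_readout hQ (ψ i) z).continuous.comp continuous_snd
    unfold logits
    fun_prop
  simp only [Function.uncurry_def, avgLoss, loss_eq]
  refine continuous_const.mul (continuous_finsetSum _ fun i _ => ?_)
  refine Continuous.sub (Continuous.log ?_ fun p => (sum_exp_pos _ (c i)).ne') (hlog i _)
  exact continuous_finsetSum _ fun a _ => (hlog i a).rexp

/-- The cotangent vector `q - e_c` of the cross-entropy has squared norm at most `2`. -/
lemma sum_sq_softmax_sub_le (u : Fin M → ℝ) (c : Fin M) :
    ∑ a, (softmax u a - if a = c then 1 else 0) ^ 2 ≤ 2 := by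
  have hpos := sum_exp_pos u c
  have h0 : ∀ a, 0 ≤ softmax u a := fun a => div_nonneg (Real.exp_pos _).le hpos.le
  have hsum : ∑ a, softmax u a = 1 := by
    simp only [softmax, ← Finset.sum_div]
    exact div_self hpos.ne'
  have h1 : ∀ a, softmax u a ≤ 1 := fun a =>
    hsum ▸ Finset.single_le_sum (fun b _ => h0 b) (Finset.mem_univ a)
  calc _ ≤ ∑ a, (softmax u a + if a = c then 1 else 0) := by
        refine Finset.sum_le_sum fun a _ => ?_
        split_ifs
        · nlinarith [h0 a, h1 a]
        · nlinarith [h0 a, h1 a]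
    _ = 2 := by
        rw [Finset.sum_add_distrib, hsum]
        norm_num

/-- The gradient of a function on a Euclidean space in terms of its partial derivatives. -/
lemma norm_sq_fderiv_eq_sum {ι : Type*} [Fintype ι] [DecidableEq ι] {f : EuclideanSpace ℝ ι → ℝ}
    {x : EuclideanSpace ℝ ι} (hf : DifferentiableAt ℝ f x) :
    ‖fderiv ℝ f x‖ ^ 2 =
      ∑ e, deriv (fun t : ℝ => f (x + t • EuclideanSpace.single e 1)) 0 ^ 2 := by
  rw [← (InnerProductSpace.toDual ℝ (EuclideanSpace ℝ ι)).symm.norm_map (fderiv ℝ f x),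
    EuclideanSpace.norm_sq_eq]
  refine Finset.sum_congr rfl fun e _ => ?_
  have h : deriv (fun t : ℝ => f (x + t • EuclideanSpace.single e 1)) 0 =
      fderiv ℝ f x (EuclideanSpace.single e 1) := hf.lineDeriv_eq_fderiv
  rw [h, ← InnerProductSpace.toDual_symm_apply, EuclideanSpace.inner_single_right]
  simp

/-- The chain rule: the derivative of the loss at `Θ` is that of the linear functional
`Wᵀ (q - e_c)` of the readout, whose coefficients are controlled by the Frobenius norm of `W`. -/
lemma norm_sq_fderiv_loss_le (hQ : 1 ≤ Q) (Θ : Params d nl nf Q) (H : Head d nl nf M)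
    {ψ : InputState d nl nf Q} (hψ : ‖ψ‖ = 1) (c : Fin M) :
    ‖fderiv ℝ (fun Θ => loss hQ Θ H ψ c) Θ‖ ^ 2 ≤
      4 * 4 ^ nf * Q * (2 * ∑ a, ∑ z, H.1 a z ^ 2) := by
  set u : Fin M → ℝ := logits H (readout hQ Θ ψ) with hu
  set v : Fin M → ℝ := fun a => softmax u a - if a = c then 1 else 0 with hv
  have hg : ∀ z, (∑ a, v a * H.1 a z) ^ 2 ≤ 2 * ∑ a, ∑ z, H.1 a z ^ 2 := fun z => by
    refine (Finset.sum_mul_sq_le_sq_mul_sq _ _ _).trans ?_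
    refine mul_le_mul (sum_sq_softmax_sub_le u c) (Finset.sum_le_sum fun a _ => ?_)
      (Finset.sum_nonneg fun a _ => sq_nonneg _) zero_le_two
    exact Finset.single_le_sum (f := fun z => H.1 a z ^ 2) (fun z _ => sq_nonneg _)
      (Finset.mem_univ z)
  rw [norm_sq_fderiv_eq_sum (differentiable_loss hQ H ψ c Θ)]
  refine le_trans (le_of_eq ?_) (sum_sq_deriv_readout_le hQ Θ hψ hg)
  refine Finset.sum_congr rfl fun e _ => ?_
  congr 1
  have hline : DifferentiableAt ℝ
      (fun t : ℝ => Θ + t • (EuclideanSpace.single e 1 : Params d nl nf Q)) 0 :=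
    ((differentiable_id.smul_const _).const_add _) 0
  have hp : ∀ z, ∃ p', HasDerivAt
      (fun t : ℝ => readout hQ (Θ + t • EuclideanSpace.single e 1) ψ z) p' 0 := fun z =>
    ⟨_, ((differentiable_readout hQ ψ z _).comp (0 : ℝ) hline).hasDerivAt⟩
  choose p' hp' using hp
  have hlogits : ∀ a, HasDerivAt (fun t : ℝ =>
      logits H (readout hQ (Θ + t • EuclideanSpace.single e 1) ψ) a)
      (∑ z, H.1 a z * p' z) 0 := fun a =>
    (HasDerivAt.fun_sum fun z _ => (hp' z).const_mul _).add_const _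
  have hloss : HasDerivAt (fun t : ℝ => loss hQ (Θ + t • EuclideanSpace.single e 1) H ψ c)
      ((∑ a, Real.exp (u a) * ∑ z, H.1 a z * p' z) / (∑ a, Real.exp (u a)) -
        ∑ z, H.1 c z * p' z) 0 := by
    simp only [loss_eq]
    have h := ((HasDerivAt.fun_sum (u := Finset.univ) fun a _ => (hlogits a).exp).log
      (sum_exp_pos _ c).ne').sub (hlogits c)
    simp only [zero_smul, add_zero] at h
    exact h
  have hlin : HasDerivAt (fun t : ℝ => ∑ z, (∑ a, v a * H.1 a z) *
      readout hQ (Θ + t • EuclideanSpace.single e 1) ψ z) (∑ z, (∑ a, v a * H.1 a z) * p' z) 0 :=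
    HasDerivAt.fun_sum fun z _ => (hp' z).const_mul _
  rw [hloss.deriv, hlin.deriv]
  have hswap : ∑ z, (∑ a, v a * H.1 a z) * p' z = ∑ a, v a * ∑ z, H.1 a z * p' z := by
    simp only [Finset.sum_mul, Finset.mul_sum, mul_assoc]
    exact Finset.sum_comm
  rw [hswap, Finset.sum_div]
  simp only [hv, sub_mul, Finset.sum_sub_distrib, ite_mul, one_mul, zero_mul, Finset.sum_ite_eq',
    Finset.mem_univ, if_true, softmax]
  congr 1
  exact Finset.sum_congr rfl fun a _ => by ring

lemma norm_quantumGradient_eq (hQ : 1 ≤ Q) (ψ : Fin N → InputState d nl nf Q) (c : Fin N → Fin M)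
    (H : Head d nl nf M) (Θ : Params d nl nf Q) :
    ‖quantumGradient hQ ψ c H Θ‖ = ‖fderiv ℝ (avgLoss hQ ψ c H) Θ‖ :=
  LinearIsometryEquiv.norm_map _ _

/-- The gradient bound for fixed parameters and fixed head: averaging over the samples does not
increase the norm. -/
lemma norm_sq_quantumGradient_le (hQ : 1 ≤ Q) {ψ : Fin N → InputState d nl nf Q}
    (hψ : ∀ i, ‖ψ i‖ = 1) (c : Fin N → Fin M) (H : Head d nl nf M) (Θ : Params d nl nf Q) :
    ‖quantumGradient hQ ψ c H Θ‖ ^ 2 ≤ 4 * 4 ^ nf * Q * (2 * ∑ a, ∑ z, H.1 a z ^ 2) := by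
  set B : ℝ := 4 * 4 ^ nf * Q * (2 * ∑ a, ∑ z, H.1 a z ^ 2) with hB
  have hB0 : 0 ≤ B := by positivity
  have heq : fderiv ℝ (avgLoss hQ ψ c H) Θ =
      (1 / (N : ℝ)) • ∑ i, fderiv ℝ (fun Θ => loss hQ Θ H (ψ i) (c i)) Θ :=
    ((HasFDerivAt.fun_sum fun i _ =>
      (differentiable_loss hQ H (ψ i) (c i) Θ).hasFDerivAt).const_mul (1 / (N : ℝ))).fderiv
  rw [norm_quantumGradient_eq, heq, ← Real.le_sqrt (norm_nonneg _) hB0, norm_smul,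
    Real.norm_of_nonneg (by positivity)]
  have hsum : ‖∑ i, fderiv ℝ (fun Θ => loss hQ Θ H (ψ i) (c i)) Θ‖ ≤ N * √B := by
    refine (norm_sum_le_of_le _ fun i _ => Real.le_sqrt_of_sq_le
      (norm_sq_fderiv_loss_le hQ Θ H (hψ i) (c i))).trans_eq ?_
    rw [Finset.sum_const, Finset.card_univ, Fintype.card_fin, nsmul_eq_mul]
  calc 1 / (N : ℝ) * _ ≤ 1 / (N : ℝ) * (N * √B) :=
        mul_le_mul_of_nonneg_left hsum (by positivity)
    _ = (N / N : ℝ) * √B := by ring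
    -- Also right for `N = 0`, where `N / N = 0`.
    _ ≤ √B := mul_le_of_le_one_left (Real.sqrt_nonneg _) (div_self_le_one _)

lemma measurable_norm_sq_quantumGradient (hQ : 1 ≤ Q) (ψ : Fin N → InputState d nl nf Q)
    (c : Fin N → Fin M) :
    Measurable fun p : Params d nl nf Q × Head d nl nf M =>
      ‖quantumGradient hQ ψ c p.2 p.1‖ ^ 2 := by
  simp only [norm_quantumGradient_eq]
  have h : Measurable fun p : Head d nl nf M × Params d nl nf Q =>
      fderiv ℝ (avgLoss hQ ψ c p.1) p.2 :=
    measurable_fderiv_with_param ℝ (continuous_uncurry_avgLoss hQ ψ c)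
  exact (h.comp measurable_swap).norm.pow_const 2

end Loss

/-! ### The random initialization -/

lemma isProbabilityMeasure_unif {a b : ℝ} (hab : a < b) : IsProbabilityMeasure (unif a b) :=
  ProbabilityTheory.cond_isProbabilityMeasure_of_finite (by simp [hab]) (by simp)

lemma integrable_sq_unif (a b : ℝ) : Integrable (fun x => x ^ 2) (unif a b) := by
  rw [unif, ProbabilityTheory.cond]
  by_cases hab : a < b
  · refine Integrable.smul_measure ?_ (by simp [hab])
    exact ((continuous_pow 2).integrableOn_Icc (a := a) (b := b)).mono_set Set.Ioo_subset_Icc_self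
  · simp [Set.Ioo_eq_empty hab]

lemma integral_sq_unif {a : ℝ} (ha : 0 < a) : ∫ x, x ^ 2 ∂unif (-a) a = a ^ 2 / 3 := by
  rw [unif, ProbabilityTheory.cond, integral_smul_measure, ← integral_Ioc_eq_integral_Ioo,
    ← intervalIntegral.integral_of_le (by linarith), integral_pow, Real.volume_Ioo,
    ENNReal.toReal_inv, ENNReal.toReal_ofReal (by linarith)]
  simp only [smul_eq_mul]
  field_simp
  ring

section Init

variable (d nl nf Q M : ℕ)

lemma isProbabilityMeasure_quantumInit : IsProbabilityMeasure (quantumInit d nl nf Q) := by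
  have := isProbabilityMeasure_unif Real.two_pi_pos
  exact Measure.isProbabilityMeasure_map (WithLp.measurable_toLp 2 _).aemeasurable

lemma inv_sqrt_outDim_pos : 0 < 1 / Real.sqrt (outDim d nl nf) := by
  have h : 0 < outDim d nl nf := by unfold outDim; positivity
  have h' : (0 : ℝ) < outDim d nl nf := by exact_mod_cast h
  positivity

lemma isProbabilityMeasure_headInit : IsProbabilityMeasure (headInit d nl nf M) := by
  have := isProbabilityMeasure_unif (neg_lt_self (inv_sqrt_outDim_pos d nl nf))
  unfold headInit
  infer_instance

lemma measurePreserving_weight (a : Fin M) (z : Idx d nl × Feat nf) :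
    MeasurePreserving (fun H : Head d nl nf M => H.1 a z) (headInit d nl nf M)
      (unif (-(1 / Real.sqrt (outDim d nl nf))) (1 / Real.sqrt (outDim d nl nf))) := by
  have := isProbabilityMeasure_unif (neg_lt_self (inv_sqrt_outDim_pos d nl nf))
  have hz := measurePreserving_eval (fun _ : Idx d nl × Feat nf =>
    unif (-(1 / Real.sqrt (outDim d nl nf))) (1 / Real.sqrt (outDim d nl nf))) z
  have ha := measurePreserving_eval (fun _ : Fin M => Measure.pi fun _ : Idx d nl × Feat nf =>
    unif (-(1 / Real.sqrt (outDim d nl nf))) (1 / Real.sqrt (outDim d nl nf))) a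
  exact hz.comp (ha.comp measurePreserving_fst)

lemma integrable_sum_sq_weights :
    Integrable (fun H : Head d nl nf M => ∑ a, ∑ z, H.1 a z ^ 2) (headInit d nl nf M) :=
  integrable_finsetSum _ fun a _ => integrable_finsetSum _ fun z _ =>
    (measurePreserving_weight d nl nf M a z).integrable_comp_of_integrable
      (integrable_sq_unif _ _)

/-- Each of the `M ⬝ D_out` weights has variance `1 / (3 ⬝ D_out)`. -/
lemma integral_sum_sq_weights :
    ∫ H : Head d nl nf M, ∑ a, ∑ z, H.1 a z ^ 2 ∂headInit d nl nf M = M / 3 := by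
  have hint : ∀ a z, Integrable (fun H : Head d nl nf M => H.1 a z ^ 2) (headInit d nl nf M) :=
    fun a z => (measurePreserving_weight d nl nf M a z).integrable_comp_of_integrable
      (integrable_sq_unif _ _)
  have hone : ∀ a z, ∫ H : Head d nl nf M, H.1 a z ^ 2 ∂headInit d nl nf M =
      1 / (3 * outDim d nl nf) := fun a z => by
    have hmp := measurePreserving_weight d nl nf M a z
    have h := integral_map (μ := headInit d nl nf M) hmp.measurable.aemeasurable
      (f := fun x : ℝ => x ^ 2) (continuous_pow 2).aestronglyMeasurable
    rw [← h, hmp.map_eq, integral_sq_unif (inv_sqrt_outDim_pos d nl nf), div_pow,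
      Real.sq_sqrt (Nat.cast_nonneg _)]
    ring
  rw [integral_finsetSum _ fun a _ => integrable_finsetSum _ fun z _ => hint a z]
  simp only [integral_finsetSum _ fun z _ => hint _ z, hone, Finset.sum_const, Finset.card_univ,
    Fintype.card_fin, Fintype.card_prod, Fintype.card_pi, Finset.prod_const, nsmul_eq_mul]
  have hcard : (((2 ^ nl) ^ d * 2 ^ nf : ℕ) : ℝ) = outDim d nl nf := by
    rw [outDim, ← pow_mul, mul_comm nl d]
  have hpos : (outDim d nl nf : ℝ) ≠ 0 := by
    have h : 0 < outDim d nl nf := by unfold outDim; positivity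
    exact_mod_cast h.ne'
  rw [hcard]
  field_simp

end Init

/-! ### The parameter count -/

lemma card_branch (d Q r : ℕ) :
    Fintype.card (Branch d Q r) = if r + 1 = Q then 1 else 2 ^ d := by
  split_ifs with h
  · simp [Branch, h]
  · simp [Branch, h]

lemma numParams_eq_sum (d nl nf Q : ℕ) :
    numParams d nl nf Q = 4 ^ nf *
      ∑ ℓ ∈ Finset.Icc 1 Q, (if ℓ = 1 then 1 else 2 ^ d) * 2 ^ (d * (nl + Q - ℓ)) := by
  have h : numParams d nl nf Q = ∑ r : Fin Q,
      4 ^ nf * ((if (r : ℕ) + 1 = Q then 1 else 2 ^ d) * 2 ^ (d * (nl + r))) := by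
    rw [numParams, Fintype.card_sigma]
    refine Finset.sum_congr rfl fun r _ => ?_
    rw [Fintype.card_prod, card_branch, Fintype.card_prod]
    simp only [Fintype.card_pi, Fintype.card_fin, Finset.prod_const, Finset.card_univ]
    rw [← pow_mul, mul_comm (nl + (r : ℕ)) d]
    ring
  rw [h, Finset.mul_sum, Fin.sum_univ_eq_sum_range
    fun r => 4 ^ nf * ((if r + 1 = Q then 1 else 2 ^ d) * 2 ^ (d * (nl + r)))]
  -- Layer `ℓ` is the one labelled by `r = Q - ℓ`.
  refine Finset.sum_nbij' (fun r => Q - r) (fun ℓ => Q - ℓ) ?_ ?_ ?_ ?_ ?_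
  · intro r hr; simp only [Finset.mem_range, Finset.mem_Icc] at *; omega
  · intro r hr; simp only [Finset.mem_range, Finset.mem_Icc] at *; omega
  · intro r hr; simp only [Finset.mem_range] at *; omega
  · intro r hr; simp only [Finset.mem_Icc] at *; omega
  · intro r hr
    rw [Finset.mem_range] at hr
    have h1 : (r + 1 = Q) = (Q - r = 1) := propext (by omega)
    have h2 : nl + Q - (Q - r) = nl + r := by omega
    simp only [h1, h2]

lemma le_numParams (d nl nf : ℕ) {Q : ℕ} (hQ : 1 ≤ Q) :
    4 ^ nf * 2 ^ (d * (nl + Q - 1)) ≤ numParams d nl nf Q := by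
  rw [numParams_eq_sum]
  refine Nat.mul_le_mul_left _ ?_
  refine le_trans (le_of_eq ?_) (Finset.single_le_sum
    (f := fun ℓ => (if ℓ = 1 then 1 else 2 ^ d) * 2 ^ (d * (nl + Q - ℓ)))
    (fun _ _ => Nat.zero_le _) (Finset.mem_Icc.2 ⟨le_rfl, hQ⟩))
  simp

/-! ### The expected gradient norm -/

/-- The pointwise bound integrated over the head; nothing about the law of `Θ` is needed. -/
lemma integrable_and_integral_norm_sq_quantumGradient_le {d nl nf Q M N : ℕ} (hQ : 1 ≤ Q)
    {ψ : Fin N → InputState d nl nf Q} (hψ : ∀ i, ‖ψ i‖ = 1) (c : Fin N → Fin M)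
    (ν : Measure (Params d nl nf Q)) [IsProbabilityMeasure ν] :
    Integrable (fun p => ‖quantumGradient hQ ψ c p.2 p.1‖ ^ 2) (ν.prod (headInit d nl nf M)) ∧
    ∫ p, ‖quantumGradient hQ ψ c p.2 p.1‖ ^ 2 ∂(ν.prod (headInit d nl nf M)) ≤
      8 * (M : ℝ) / 3 * 4 ^ nf * Q ∧
    ∫ p, 1 / (numParams d nl nf Q : ℝ) * ‖quantumGradient hQ ψ c p.2 p.1‖ ^ 2
        ∂(ν.prod (headInit d nl nf M)) ≤
      8 * (M : ℝ) * Q / (3 * 2 ^ (d * (nl + Q - 1))) := by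
  have := isProbabilityMeasure_headInit d nl nf M
  have hdom : Integrable (fun p : Params d nl nf Q × Head d nl nf M =>
      4 * 4 ^ nf * Q * (2 * ∑ a, ∑ z, p.2.1 a z ^ 2)) (ν.prod (headInit d nl nf M)) :=
    (((integrable_sum_sq_weights d nl nf M).comp_snd ν).const_mul 2).const_mul _
  have hint : Integrable (fun p => ‖quantumGradient hQ ψ c p.2 p.1‖ ^ 2)
      (ν.prod (headInit d nl nf M)) := by
    refine hdom.mono' (measurable_norm_sq_quantumGradient hQ ψ c).aestronglyMeasurable
      (Filter.Eventually.of_forall fun p => ?_)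
    rw [Real.norm_of_nonneg (sq_nonneg _)]
    exact norm_sq_quantumGradient_le hQ hψ c p.2 p.1
  have hle : ∫ p, ‖quantumGradient hQ ψ c p.2 p.1‖ ^ 2 ∂(ν.prod (headInit d nl nf M)) ≤
      8 * (M : ℝ) / 3 * 4 ^ nf * Q := by
    refine (integral_mono hint hdom fun p =>
      norm_sq_quantumGradient_le hQ hψ c p.2 p.1).trans_eq ?_
    rw [integral_const_mul, integral_const_mul,
      integral_fun_snd (fun H : Head d nl nf M => ∑ a, ∑ z, H.1 a z ^ 2),
      integral_sum_sq_weights]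
    simp only [probReal_univ, one_smul]
    ring
  refine ⟨hint, hle, ?_⟩
  have hcount : (4 : ℝ) ^ nf * 2 ^ (d * (nl + Q - 1)) ≤ numParams d nl nf Q := by
    exact_mod_cast le_numParams d nl nf hQ
  have hpos : (0 : ℝ) < 4 ^ nf * 2 ^ (d * (nl + Q - 1)) := by positivity
  rw [integral_const_mul]
  calc _ ≤ 1 / (4 ^ nf * 2 ^ (d * (nl + Q - 1)) : ℝ) * (8 * (M : ℝ) / 3 * 4 ^ nf * Q) :=
        mul_le_mul (one_div_le_one_div_of_le hpos hcount) hle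
          (integral_nonneg fun _ => sq_nonneg _) (by positivity)
    _ = 8 * (M : ℝ) * Q / (3 * 2 ^ (d * (nl + Q - 1))) := by
        field_simp

end PCSQCNN

theorem mainTheorem3 (d nl nf Q M N : ℕ) (hQ : 1 ≤ Q) (hN : 1 ≤ N)
    (ψ : Fin N → InputState d nl nf Q) (hψ : ∀ i, ‖ψ i‖ = 1) (c : Fin N → Fin M) :
    -- parameter count
    numParams d nl nf Q =
        4 ^ nf * ∑ ℓ ∈ Finset.Icc 1 Q, (if ℓ = 1 then 1 else 2 ^ d) * 2 ^ (d * (nl + Q - ℓ)) ∧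
    4 ^ nf * 2 ^ (d * (nl + Q - 1)) ≤ numParams d nl nf Q ∧
    -- the gradient is a genuine derivative
    (∀ H : Head d nl nf M, Differentiable ℝ (avgLoss hQ ψ c H)) ∧
    -- bounds for every quantum initialization that is independent of the head
    (∀ ν : Measure (Params d nl nf Q), IsProbabilityMeasure ν →
      Integrable (fun p => ‖quantumGradient hQ ψ c p.2 p.1‖ ^ 2)
          (ν.prod (headInit d nl nf M)) ∧
      ∫ p, ‖quantumGradient hQ ψ c p.2 p.1‖ ^ 2 ∂(ν.prod (headInit d nl nf M)) ≤
        8 * (M : ℝ) / 3 * 4 ^ nf * Q ∧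
      ∫ p, 1 / (numParams d nl nf Q : ℝ) * ‖quantumGradient hQ ψ c p.2 p.1‖ ^ 2
          ∂(ν.prod (headInit d nl nf M)) ≤
        8 * (M : ℝ) * Q / (3 * 2 ^ (d * (nl + Q - 1)))) ∧
    -- the uniform benchmark initialization
    IsProbabilityMeasure (quantumInit d nl nf Q) ∧
    IsProbabilityMeasure (headInit d nl nf M) ∧
    Integrable (fun p => ‖quantumGradient hQ ψ c p.2 p.1‖ ^ 2)
        ((quantumInit d nl nf Q).prod (headInit d nl nf M)) ∧
    ∫ p, ‖quantumGradient hQ ψ c p.2 p.1‖ ^ 2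
        ∂((quantumInit d nl nf Q).prod (headInit d nl nf M)) ≤
      8 * (M : ℝ) / 3 * 4 ^ nf * Q ∧
    ∫ p, 1 / (numParams d nl nf Q : ℝ) * ‖quantumGradient hQ ψ c p.2 p.1‖ ^ 2
        ∂((quantumInit d nl nf Q).prod (headInit d nl nf M)) ≤
      8 * (M : ℝ) * Q / (3 * 2 ^ (d * (nl + Q - 1))) := by
  have hq := isProbabilityMeasure_quantumInit d nl nf Q
  exact ⟨numParams_eq_sum d nl nf Q, le_numParams d nl nf hQ,
    differentiable_avgLoss hQ ψ c,
    fun ν _ => integrable_and_integral_norm_sq_quantumGradient_le hQ hψ c ν, hq,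
    isProbabilityMeasure_headInit d nl nf M,
    integrable_and_integral_norm_sq_quantumGradient_le hQ hψ c (quantumInit d nl nf Q)⟩
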